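/- Equip $\mathbb{R}^d$ with the sup norm, let $B_r(x)$ be the closed ball of radius $r$ about $x$ and $B_1=B_1(0)=[-1,1]^d$. For sets, $\dim$ is Hausdorff dimension. A measure $\mu$ is exact dimensional with $\dim\mu=\alpha$ if $\lim_{r\to 0}\log\mu(B_r(x))/\log r=\alpha$ for $\mu$-a.e. $x$; its upper dimension $\overline{\dim}\,\mu$ is the $\mu$-essential supremum of $x\mapsto\limsup_{r\to 0}\log\mu(B_r(x))/\log r$. Definitions. For a ball $E=B_r(c)$ put $T_E(y)=(y-c)/r$. A miniset of a compact set $X\subseteq\mathbb{R}^d$ is a set $B_1\cap T_E X$ with $E$ a ball; a microset is a limit of minisets in the Hausdorff metric on closed subsets of $B_1$; $X$ is homogeneous if every microset of $X$ is a subset of some miniset of $X$. For a Radon measure $\mu$ on $\mathbb{R}^d$ let $T_x\mu$ and $S_t\mu$ be its push-forwards under $y\mapsto y-x$ and $y\mapsto e^t y$, let $\mu^*=\mu/\mu(B_1)$, let $\mu^\square$ be $\mu$ restricted to $B_1$ and normalized to mass $1$, and put $T_x^*\mu=(T_x\mu)^*$, $S_t^*\mu=(S_t\mu)^*$. An ergodic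 fractal distribution (EFD) is a probability distribution $P$ on the set of Radon measures $\nu$ with $\nu(B_1)=1$ (and $0\in\operatorname{supp}\nu$ for $P$-a.e. $\nu$) that is invariant and ergodic under the flow $(S_t^*)_{t\in\mathbb{R}}$ and quasi-Palm: for every bounded open neighbourhood $U$ of $0$, a measurable set $\mathcal{A}$ is $P$-null if and only if for $P$-a.e. $\nu$ and $\nu$-a.e. $x\in U$ one has $T_x^*\nu\notin\mathcal{A}$. A nonzero Radon measure $\mu$ is a uniformly scaling measure (USM) generating $P$ if for $\mu$-a.e. $x$ the distributions $\frac1T\int_0^T\delta_{(S_tT_x\mu)^\square}\,dt$ converge weak-* as $T\to\infty$, as probability measures on the compact space of probability measures on $B_1$, to the image of $P$ under $\nu\mapsto\nu^\square$. Theorem. Let $C\subseteq[0,1]$ be the Cantor set obtained by removing from $[0,1]$ the open middle interval of proportion $8/20$ and iterating, and let $X=C\times C\subseteq\mathbb{R}^2$. (1) $X$ is homogeneous, and there is a $C^\infty$ map $f:\mathbb{R}^2\to\mathbb{R}$ that is injective on $X$ and satisfies $\dim f(X)<\dim X$. Hence dimension conservation fails for $f$: $\dim f(X)+\dim(X\cap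 f^{-1}(y))<\dim X$ for every $y\in f(X)$. (2) There are a probability measure $\mu$ on $\mathbb{R}^2$, an EFD $P$ and a number $\alpha>1$ such that $\mu$ is a USM generating $P$, $\mu$ and $P$-a.e. $\nu$ are exact dimensional of dimension $\alpha$, and the coordinate projection $\pi(x,y)=x$ is injective on $\operatorname{supp}\mu$. Moreover dimension conservation fails for $\mu$: $\overline{\dim}\,\pi\mu+\overline{\dim}\,\mu_{[z]_\pi}<\alpha=\dim\mu$ for $\mu$-a.e. $z$, where $\mu_{[z]_\pi}$ is the conditional measure of $\mu$ on the fibre $[z]_\pi=\pi^{-1}(\pi(z))$. -/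

import Mathlib

open Set Filter Topology MeasureTheory
open scoped ENNReal ContDiff

noncomputable section

/-! `ℝ^d` is `Fin d → ℝ` with the sup norm, so `Metric.closedBall 0 1` is the cube `[-1,1]^d`. -/

/-! ### Minisets, microsets, homogeneous sets -/

/-- The miniset `B₁ ∩ T_E X` of `X`, where `E` is the closed ball of radius `r` about `c` and
`T_E y = (y - c) / r` is the homothety mapping `E` onto the unit ball `B₁`. -/
def miniset {d : ℕ} (X : Set (Fin d → ℝ)) (c : Fin d → ℝ) (r : ℝ) : Set (Fin d → ℝ) :=
  Metric.closedBall 0 1 ∩ (fun y => r⁻¹ • (y - c)) '' X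

/-- A microset of `X`: a closed subset of `B₁` that is a limit of minisets of `X` in the
Hausdorff metric. -/
def IsMicroset {d : ℕ} (X M : Set (Fin d → ℝ)) : Prop :=
  IsClosed M ∧ M ⊆ Metric.closedBall 0 1 ∧
    ∃ (c : ℕ → Fin d → ℝ) (r : ℕ → ℝ), (∀ n, 0 < r n) ∧
      Tendsto (fun n => Metric.hausdorffEDist (miniset X (c n) (r n)) M) atTop (𝓝 0)

/-- A compact set is homogeneous if each of its microsets is a subset of one of its minisets. -/
def IsHomogeneousSet {d : ℕ} (X : Set (Fin d → ℝ)) : Prop :=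
  IsCompact X ∧ ∀ M, IsMicroset X M → ∃ (c : Fin d → ℝ) (r : ℝ), 0 < r ∧ M ⊆ miniset X c r

/-! ### The Cantor set -/

/-- Stage `n` of the construction of the Cantor set: start from `[0,1]` and remove the open
middle `8/20` of each interval, leaving two intervals of `6/20` of its length. -/
def preCantor : ℕ → Set ℝ
  | 0 => Icc 0 1
  | n + 1 => (fun x => 6 / 20 * x) '' preCantor n ∪ (fun x => 14 / 20 + 6 / 20 * x) '' preCantor n

/-- The Cantor set obtained from `[0,1]` by removing the middle `8/20` and iterating. -/
def cantorC : Set ℝ := ⋂ n, preCantor n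

/-- The product of the Cantor set with itself, in the plane. -/
def cantorSquare : Set (Fin 2 → ℝ) := {p | p 0 ∈ cantorC ∧ p 1 ∈ cantorC}

/-! ### Dimension of measures -/

/-- The quotient `log μ(B_r(x)) / log r`, whose behaviour as `r → 0` is the local dimension. -/
def localDimQuot {E : Type*} [PseudoMetricSpace E] [MeasurableSpace E] (μ : Measure E) (x : E)
    (r : ℝ) : ℝ :=
  Real.log (μ.real (Metric.closedBall x r)) / Real.log r

/-- `μ` is exact dimensional, of dimension `α`. -/
def HasExactDim {E : Type*} [PseudoMetricSpace E] [MeasurableSpace E] (μ : Measure E)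
    (α : ℝ) : Prop :=
  ∀ᵐ x ∂μ, Tendsto (localDimQuot μ x) (𝓝[>] 0) (𝓝 α)

/-- The upper dimension of `μ`: the essential supremum of its upper local dimension. -/
def upperDim {E : Type*} [PseudoMetricSpace E] [MeasurableSpace E] (μ : Measure E) : EReal :=
  essSup (fun x => limsup (fun r => (localDimQuot μ x r : EReal)) (𝓝[>] 0)) μ

/-! ### Translation, scaling and normalization of measures -/

/-- `μ* = μ / μ(B₁)`. -/
def starNorm {d : ℕ} (μ : Measure (Fin d → ℝ)) : Measure (Fin d → ℝ) :=
  (μ (Metric.closedBall 0 1))⁻¹ • μ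

/-- `T_x μ`, the push-forward of `μ` under `y ↦ y - x`. -/
def translateMeas {d : ℕ} (x : Fin d → ℝ) (μ : Measure (Fin d → ℝ)) : Measure (Fin d → ℝ) :=
  μ.map (fun y => y - x)

/-- `S_t μ`, the push-forward of `μ` under `y ↦ e^t y`. -/
def scaleMeas {d : ℕ} (t : ℝ) (μ : Measure (Fin d → ℝ)) : Measure (Fin d → ℝ) :=
  μ.map (fun y => Real.exp t • y)

open Classical in
/-- `μ^□`: the measure `μ` restricted to `B₁` and normalized to mass one, as a probability measure
on `B₁`. (The value is irrelevant where this is undefined, i.e. where `μ(B₁)` is `0` or `∞`.) -/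
def boxNorm {d : ℕ} (μ : Measure (Fin d → ℝ)) :
    ProbabilityMeasure (Metric.closedBall (0 : Fin d → ℝ) 1) :=
  ⟨if IsProbabilityMeasure ((μ (Metric.closedBall 0 1))⁻¹ •
      μ.comap ((↑) : Metric.closedBall (0 : Fin d → ℝ) 1 → Fin d → ℝ)) then
    (μ (Metric.closedBall 0 1))⁻¹ •
      μ.comap ((↑) : Metric.closedBall (0 : Fin d → ℝ) 1 → Fin d → ℝ)
    else Measure.dirac ⟨0, Metric.mem_closedBall_self zero_le_one⟩,
    by split_ifs with h; exacts [h, inferInstance]⟩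

/-! ### Fractal distributions

A distribution is a probability measure on the space of measures, with its σ-algebra generated by
the evaluations `ν ↦ ν A`. -/

/-- `P` is a probability distribution on the set `ℳ*` of Radon measures `ν` with `ν(B₁) = 1`,
concentrated on those `ν` with `0 ∈ supp ν`, where the flow `S*` is defined. -/
def IsDistribution {d : ℕ} (P : Measure (Measure (Fin d → ℝ))) : Prop :=
  IsProbabilityMeasure P ∧ ∀ᵐ ν ∂P,
    IsLocallyFiniteMeasure ν ∧ ν (Metric.closedBall 0 1) = 1 ∧ (0 : Fin d → ℝ) ∈ ν.support

/-- `P` is invariant under the flow `S_t* ν = (S_t ν)*`. -/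
def IsScaleInvariant {d : ℕ} (P : Measure (Measure (Fin d → ℝ))) : Prop :=
  ∀ t : ℝ, MeasurePreserving (fun ν => starNorm (scaleMeas t ν)) P P

/-- `P` is quasi-Palm: for every bounded open neighbourhood `U` of the origin, `P` has the same
null sets as the law of `T_x* ν`, where `ν` is chosen by `P` and then `x ∈ U` by `ν`. -/
def IsQuasiPalm {d : ℕ} (P : Measure (Measure (Fin d → ℝ))) : Prop :=
  ∀ U : Set (Fin d → ℝ), IsOpen U → Bornology.IsBounded U → 0 ∈ U →
    ∀ A : Set (Measure (Fin d → ℝ)), MeasurableSet A →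
      (P A = 0 ↔ ∀ᵐ ν ∂P, ∀ᵐ x ∂(ν.restrict U), starNorm (translateMeas x ν) ∉ A)

/-- Fractal distributions. -/
def IsFD {d : ℕ} (P : Measure (Measure (Fin d → ℝ))) : Prop :=
  IsDistribution P ∧ IsScaleInvariant P ∧ IsQuasiPalm P

/-- Ergodic fractal distributions. -/
def IsEFD {d : ℕ} (P : Measure (Measure (Fin d → ℝ))) : Prop :=
  IsFD P ∧ ∀ A : Set (Measure (Fin d → ℝ)), MeasurableSet A →
    (∀ t : ℝ, P (symmDiff ((fun ν => starNorm (scaleMeas t ν)) ⁻¹' A) A) = 0) →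
      P A = 0 ∨ P A = 1

/-! ### Uniformly scaling measures -/

/-- The scenery `μ_{x,t}^□ = (S_t T_x μ)^□` of `μ` at `x`. -/
def scenery {d : ℕ} (μ : Measure (Fin d → ℝ)) (x : Fin d → ℝ) (t : ℝ) :
    ProbabilityMeasure (Metric.closedBall (0 : Fin d → ℝ) 1) :=
  boxNorm (scaleMeas t (translateMeas x μ))

/-- `μ` generates `P` at `x ∈ supp μ`: as `T → ∞`, the scenery distributions
`(1/T) ∫_0^T δ_{μ_{x,t}^□} dt` converge, in the weak-* topology of the probability measures on
the compact space of probability measures on `B₁`, to the restricted version `P^□` of `P`. -/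
def GeneratesAt {d : ℕ} (μ : Measure (Fin d → ℝ)) (x : Fin d → ℝ)
    (P : Measure (Measure (Fin d → ℝ))) : Prop :=
  x ∈ μ.support ∧
    ∀ F : C(ProbabilityMeasure (Metric.closedBall (0 : Fin d → ℝ) 1), ℝ),
      Tendsto (fun T : ℝ => T⁻¹ * ∫ t in (0 : ℝ)..T, F (scenery μ x t)) atTop
        (𝓝 (∫ ν, F (boxNorm ν) ∂P))

/-- `μ` is a (nonzero, Radon) uniformly scaling measure generating `P`. -/
def IsUSMGenerating {d : ℕ} (μ : Measure (Fin d → ℝ)) (P : Measure (Measure (Fin d → ℝ))) :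
    Prop :=
  IsLocallyFiniteMeasure μ ∧ μ ≠ 0 ∧ ∀ᵐ x ∂μ, GeneratesAt μ x P

/-- The coordinate projection `π(x,y) = x` of the plane. -/
def proj₁ (p : Fin 2 → ℝ) : ℝ := p 0

/-- The conditional measure `μ_{[x]_π}` of `μ` on the fibre of `proj₁` through `x`, given by the
disintegration of `μ` over the σ-algebra generated by `proj₁`. -/
def fibreMeas (μ : Measure (Fin 2 → ℝ)) [IsFiniteMeasure μ] (x : Fin 2 → ℝ) :
    Measure (Fin 2 → ℝ) :=
  ProbabilityTheory.condExpKernel μ (MeasurableSpace.comap proj₁ inferInstance) x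

end

/-! ### The Cantor set and its digits -/

/-! Both counterexamples rest on one remark: an injection into the line has one-point fibres and an
image of dimension at most 1, so dimension conservation fails as soon as the source has dimension
above 1. The work is to find such injections that are smooth, respectively linear, on sources of the
required kind.

Sets. The product is self-similar with ratio 3/10, and its first-level pieces are separated. Hence a
miniset of any scale lies in one whose radius is in `[1/5, 2/3]`, and compactness of this range of
radii, and of the relevant centres, gives homogeneity (`isHomogeneousSet_cantorSquare`). Reading
Cantor digits as binary digits is a Hölder map of exponent 5/9 onto a set containing the unit
square, so the dimension is at least 10/9 (`one_lt_dimH_cantorSquare`). Each digit is locally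
constant on the product, so it extends to a smooth compactly supported function. A sum of all these
digit functions with very rapidly decreasing weights is smooth and still determines every digit
(`exists_contDiff_injOn_cantorSquare`).

Measures. Toss independent fair coins for the binary digits of `x` and `y`, except that the digits
of `x` at positions `4 ^ j` and `2 * 4 ^ j` are the `j`-th digit of `y` and its complement. Then `x`
determines `y`: the complementary pairs put infinitely many zeros in the expansion of `x`, which
makes it unique (`injOn_proj₁_range_codedPoint`). All points so coded form a compact set, so
injectivity holds on the whole support, and the fibre measures are point masses. The first `n`
positions contain only about `log n` coding ones, so dyadic cells have mass `4 ^ (-n)` up to a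
factor linear in `n`, and the dimension is 2 (`codedMeasure_closedBall_bounds`), whereas the
projection has upper dimension at most 1.

The generated distribution is the point mass at normalized Lebesgue measure, which is fixed by all
normalized translations and scalings (`isEFD_lebesgueEFD`). Between consecutive coding positions the
measure is uniform over the subcells of each charged dyadic cell. A typical point stays away from
the boundary of its cell, by Borel-Cantelli, so its scenery there is close to Lebesgue
(`tendsto_scenery_goodTimes`). The remaining times up to `T` have length `O(log² T)` and do not
affect the averages (`generatesAt_codedPoint`). -/

theorem isCompact_preCantor (n : ℕ) : IsCompact (preCantor n) := by
  induction n with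
  | zero => exact isCompact_Icc
  | succ n ih => exact (ih.image (by fun_prop)).union (ih.image (by fun_prop))

theorem isCompact_cantorC : IsCompact cantorC :=
  (isCompact_preCantor 0).of_isClosed_subset
    (isClosed_iInter fun n => (isCompact_preCantor n).isClosed) (iInter_subset _ 0)

theorem cantorC_subset_Icc : cantorC ⊆ Icc 0 1 := iInter_subset preCantor 0

/-- The contraction of the line onto the piece of the Cantor set with first digit `e`. -/
noncomputable def branch (e : Fin 2) (x : ℝ) : ℝ := 14 / 20 * (e : ℕ) + 6 / 20 * x

/-- The first Cantor digit. -/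
noncomputable def firstDigit (x : ℝ) : Fin 2 := if x ≤ 1 / 2 then 0 else 1

/-- The expanding map inverting the branches. -/
noncomputable def expand (x : ℝ) : ℝ := (x - 14 / 20 * ((firstDigit x : Fin 2) : ℕ)) / (6 / 20)

theorem branch_expand (x : ℝ) : branch (firstDigit x) (expand x) = x := by
  unfold branch expand; ring

theorem branch_mem_preCantor (e : Fin 2) {n : ℕ} {x : ℝ} (hx : x ∈ preCantor n) :
    branch e x ∈ preCantor (n + 1) := by
  fin_cases e
  · exact Or.inl ⟨x, hx, by simp [branch]⟩
  · exact Or.inr ⟨x, hx, by simp [branch]⟩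

theorem preCantor_succ_subset_zero (n : ℕ) : preCantor n ⊆ Icc 0 1 := by
  induction n with
  | zero => exact subset_rfl
  | succ n ih =>
    rintro _ (⟨x, hx, rfl⟩ | ⟨x, hx, rfl⟩) <;> have := ih hx <;> simp only [mem_Icc] at this ⊢ <;>
      constructor <;> linarith

theorem branch_mem_cantorC (e : Fin 2) {x : ℝ} (hx : x ∈ cantorC) : branch e x ∈ cantorC :=
  mem_iInter.2 fun n => by
    cases n with
    | zero => exact preCantor_succ_subset_zero 1 (branch_mem_preCantor e (mem_iInter.1 hx 0))
    | succ n => exact branch_mem_preCantor e (mem_iInter.1 hx n)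

theorem expand_mem_preCantor {n : ℕ} {x : ℝ} (hx : x ∈ preCantor (n + 1)) :
    expand x ∈ preCantor n := by
  obtain ⟨y, hy, rfl⟩ | ⟨y, hy, rfl⟩ := hx
  · have h := preCantor_succ_subset_zero n hy
    have : firstDigit (6 / 20 * y) = 0 := if_pos (by linarith [h.2])
    simpa [expand, this] using hy
  · have h := preCantor_succ_subset_zero n hy
    have : firstDigit (14 / 20 + 6 / 20 * y) = 1 := if_neg (by linarith [h.1])
    simpa [expand, this] using hy

theorem expand_mem_cantorC {x : ℝ} (hx : x ∈ cantorC) : expand x ∈ cantorC :=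
  mem_iInter.2 fun n => expand_mem_preCantor (mem_iInter.1 hx (n + 1))

theorem firstDigit_branch (e : Fin 2) {x : ℝ} (hx : x ∈ Icc (0 : ℝ) 1) :
    firstDigit (branch e x) = e := by
  obtain ⟨h0, h1⟩ := hx
  fin_cases e
  · exact if_pos (by simp [branch]; linarith)
  · exact if_neg (by simp [branch]; linarith)

theorem expand_branch (e : Fin 2) {x : ℝ} (hx : x ∈ Icc (0 : ℝ) 1) :
    expand (branch e x) = x := by
  rw [expand, firstDigit_branch e hx, branch]; ring

/-- The two first-level pieces are separated by a gap of length 14/20 - 6/20 = 2/5. -/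
theorem firstDigit_eq_of_abs_sub_lt {x y : ℝ} (hx : x ∈ cantorC) (hy : y ∈ cantorC)
    (h : |x - y| < 2 / 5) : firstDigit x = firstDigit y := by
  have key : ∀ {x y : ℝ}, x ∈ cantorC → y ∈ cantorC → |x - y| < 2 / 5 → x ≤ 1 / 2 → y ≤ 1 / 2 := by
    intro x y hx hy h hx2
    by_contra! hy2
    have hx0 : firstDigit x = 0 := if_pos hx2
    have hy0 : firstDigit y = 1 := if_neg hy2.not_ge
    have h1 := cantorC_subset_Icc (expand_mem_cantorC hx)
    have h2 := cantorC_subset_Icc (expand_mem_cantorC hy)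
    have h3 := branch_expand x
    have h4 := branch_expand y
    simp only [hx0, hy0, branch] at h3 h4
    norm_num at h3 h4
    have := (abs_lt.1 h).1
    linarith [h1.2, h2.1]
  have : x ≤ 1 / 2 ↔ y ≤ 1 / 2 := ⟨key hx hy h, key hy hx (by rwa [abs_sub_comm])⟩
  simp only [firstDigit, this]

theorem abs_sub_eq_of_firstDigit_eq {x y : ℝ} (h : firstDigit x = firstDigit y) :
    |x - y| = 6 / 20 * |expand x - expand y| := by
  conv_lhs => rw [← branch_expand x, ← branch_expand y, h]
  rw [branch, branch, ← abs_of_pos (show (0 : ℝ) < 6 / 20 by norm_num), ← abs_mul]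
  congr 1
  rw [abs_of_pos (by norm_num)]; ring

/-! ### Homogeneity of the Cantor square -/

theorem isCompact_cantorSquare : IsCompact cantorSquare := by
  have : cantorSquare = Set.univ.pi fun _ : Fin 2 => cantorC := by
    ext p; simp [cantorSquare, Fin.forall_fin_two]
  rw [this]
  exact isCompact_univ_pi fun _ => isCompact_cantorC

theorem mem_cantorSquare {p : Fin 2 → ℝ} : p ∈ cantorSquare ↔ ∀ i, p i ∈ cantorC := by
  simp [cantorSquare, Fin.forall_fin_two]

theorem mem_miniset {d : ℕ} {X : Set (Fin d → ℝ)} {c p : Fin d → ℝ} {r : ℝ} (hr : 0 < r) :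
    p ∈ miniset X c r ↔ ‖p‖ ≤ 1 ∧ c + r • p ∈ X := by
  simp only [miniset, mem_inter_iff, mem_closedBall_zero_iff, mem_image]
  refine and_congr_right fun _ => ⟨?_, fun h => ⟨_, h, ?_⟩⟩
  · rintro ⟨y, hy, rfl⟩
    rwa [smul_smul, mul_inv_cancel₀ hr.ne', one_smul, add_sub_cancel]
  · rw [add_sub_cancel_left, smul_smul, inv_mul_cancel₀ hr.ne', one_smul]

/-- The contraction by 6/20 maps the product into itself, so a large window can be replaced by a
smaller one. -/
theorem miniset_cantorSquare_subset_shrink (c : Fin 2 → ℝ) {r : ℝ} (hr : 0 < r) :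
    miniset cantorSquare c r ⊆ miniset cantorSquare ((6 / 20 : ℝ) • c) (6 / 20 * r) := by
  intro p hp
  rw [mem_miniset hr] at hp
  rw [mem_miniset (by positivity)]
  refine ⟨hp.1, ?_⟩
  rw [mul_smul, ← smul_add, mem_cantorSquare]
  intro i
  have := branch_mem_cantorC 0 (mem_cantorSquare.1 hp.2 i)
  simpa [branch] using this

/-- A window of diameter below the gap 2/5 meets only one first-level piece; blowing that piece up
to the whole product enlarges the window. Any point `q` of the miniset tells which piece it is. -/
theorem miniset_cantorSquare_subset_expand (c : Fin 2 → ℝ) {r : ℝ} (hr : 0 < r) (hr' : r < 1 / 5) :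
    ∃ c', miniset cantorSquare c r ⊆ miniset cantorSquare c' (r / (6 / 20)) := by
  rcases (miniset cantorSquare c r).eq_empty_or_nonempty with h | ⟨q, hq⟩
  · exact ⟨0, by simp [h]⟩
  rw [mem_miniset hr] at hq
  refine ⟨fun i => (c i - 14 / 20 * ((firstDigit ((c + r • q) i) : Fin 2) : ℕ)) / (6 / 20), ?_⟩
  intro p hp
  rw [mem_miniset hr] at hp
  rw [mem_miniset (by positivity)]
  refine ⟨hp.1, mem_cantorSquare.2 fun i => ?_⟩
  have h1 := mem_cantorSquare.1 hp.2 i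
  have h2 := mem_cantorSquare.1 hq.2 i
  have h3 : firstDigit ((c + r • p) i) = firstDigit ((c + r • q) i) := by
    refine firstDigit_eq_of_abs_sub_lt h1 h2 ?_
    have hp1 := abs_le.1 ((norm_le_pi_norm p i).trans hp.1)
    have hq1 := abs_le.1 ((norm_le_pi_norm q i).trans hq.1)
    have : (c + r • p) i - (c + r • q) i = r * (p i - q i) := by simp; ring
    rw [this, abs_mul, abs_of_pos hr]
    have : |p i - q i| ≤ 2 := abs_le.2 ⟨by linarith, by linarith⟩
    nlinarith
  have h4 := expand_mem_cantorC h1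
  rw [expand, h3] at h4
  convert h4 using 1
  simp only [Pi.add_apply, Pi.smul_apply, smul_eq_mul]
  ring

/-- The ends of `[1/5, 2/3]` have ratio exactly 20/6, so a shrinking step from above 2/3 cannot jump
below 1/5; likewise an expanding step from below 1/5 cannot pass 2/3 in the companion lemma. -/
theorem exists_miniset_cantorSquare_subset_of_le (n : ℕ) : ∀ (c : Fin 2 → ℝ) (r : ℝ), 1 / 5 ≤ r →
    r ≤ 2 / 3 * (20 / 6) ^ n → ∃ (c' : Fin 2 → ℝ) (r' : ℝ), r' ∈ Icc (1 / 5 : ℝ) (2 / 3) ∧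
      miniset cantorSquare c r ⊆ miniset cantorSquare c' r' := by
  induction n with
  | zero => exact fun c r h1 h2 => ⟨c, r, ⟨h1, by simpa using h2⟩, subset_rfl⟩
  | succ n ih =>
    intro c r h1 h2
    by_cases hr : r ≤ 2 / 3
    · exact ⟨c, r, ⟨h1, hr⟩, subset_rfl⟩
    · push Not at hr
      obtain ⟨c', r', h, h'⟩ := ih ((6 / 20 : ℝ) • c) (6 / 20 * r) (by linarith)
        (by rw [pow_succ] at h2; linarith)
      exact ⟨c', r', h, (miniset_cantorSquare_subset_shrink c (by linarith)).trans h'⟩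

theorem exists_miniset_cantorSquare_subset_of_ge (n : ℕ) : ∀ (c : Fin 2 → ℝ) (r : ℝ), r ≤ 2 / 3 →
    1 / 5 * (6 / 20) ^ n ≤ r → ∃ (c' : Fin 2 → ℝ) (r' : ℝ), r' ∈ Icc (1 / 5 : ℝ) (2 / 3) ∧
      miniset cantorSquare c r ⊆ miniset cantorSquare c' r' := by
  induction n with
  | zero => exact fun c r h1 h2 => ⟨c, r, ⟨by simpa using h2, h1⟩, subset_rfl⟩
  | succ n ih =>
    intro c r h1 h2
    by_cases hr : 1 / 5 ≤ r
    · exact ⟨c, r, ⟨hr, h1⟩, subset_rfl⟩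
    · push Not at hr
      have h0 : 0 < r := lt_of_lt_of_le (by positivity) h2
      obtain ⟨c₁, h3⟩ := miniset_cantorSquare_subset_expand c h0 hr
      obtain ⟨c', r', h, h'⟩ := ih c₁ (r / (6 / 20)) (by linarith)
        (by rw [pow_succ] at h2; linarith)
      exact ⟨c', r', h, h3.trans h'⟩

theorem exists_miniset_cantorSquare_subset (c : Fin 2 → ℝ) {r : ℝ} (hr : 0 < r) :
    ∃ (c' : Fin 2 → ℝ) (r' : ℝ), r' ∈ Icc (1 / 5 : ℝ) (2 / 3) ∧
      miniset cantorSquare c r ⊆ miniset cantorSquare c' r' := by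
  by_cases h : 1 / 5 ≤ r
  · obtain ⟨n, hn⟩ := pow_unbounded_of_one_lt (r / (2 / 3)) (show (1 : ℝ) < 20 / 6 by norm_num)
    exact exists_miniset_cantorSquare_subset_of_le n c r h (by linarith)
  · obtain ⟨n, hn⟩ := exists_pow_lt_of_lt_one (show 0 < r * 5 by positivity)
      (show (6 / 20 : ℝ) < 1 by norm_num)
    exact exists_miniset_cantorSquare_subset_of_ge n c r (by linarith) (by linarith)

theorem isHomogeneousSet_cantorSquare : IsHomogeneousSet cantorSquare := by
  refine ⟨isCompact_cantorSquare, fun M ⟨_, hM1, c, r, hr, hlim⟩ => ?_⟩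
  rcases M.eq_empty_or_nonempty with rfl | hne
  · exact ⟨0, 1, one_pos, empty_subset _⟩
  choose c' r' hr' hsub using fun n => exists_miniset_cantorSquare_subset (c n) (hr n)
  have hr0 : ∀ n, 0 < r' n := fun n => lt_of_lt_of_le (by norm_num) (hr' n).1
  -- Minisets at finite Hausdorff distance from the nonempty `M` are nonempty. A point `p` of one
  -- gives `c' n + r' n • p` in the unit square, so the centre has norm at most 1 + 2/3.
  have hev : ∀ᶠ n in atTop, Metric.hausdorffEDist (miniset cantorSquare (c n) (r n)) M ≠ ⊤ ∧
      c' n ∈ Metric.closedBall (0 : Fin 2 → ℝ) 2 := by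
    filter_upwards [hlim.eventually (gt_mem_nhds ENNReal.zero_lt_top)] with n hn
    refine ⟨hn.ne, ?_⟩
    obtain ⟨p, hp⟩ := Metric.nonempty_of_hausdorffEDist_ne_top hne
      (by rw [Metric.hausdorffEDist_comm]; exact hn.ne)
    have hp := (mem_miniset (hr0 n)).1 (hsub n hp)
    rw [mem_closedBall_zero_iff, pi_norm_le_iff_of_nonneg (by norm_num)]
    intro i
    have h1 := cantorC_subset_Icc (mem_cantorSquare.1 hp.2 i)
    have h2 := abs_le.1 ((norm_le_pi_norm p i).trans hp.1)
    simp only [Pi.add_apply, Pi.smul_apply, smul_eq_mul, mem_Icc] at h1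
    have h3 := (hr' n).2
    have h4 := hr0 n
    rw [Real.norm_eq_abs, abs_le]
    constructor <;> nlinarith
  obtain ⟨N, hN⟩ := eventually_atTop.1 hev
  obtain ⟨⟨c₀, r₀⟩, hmem, φ, hφ, hconv⟩ :=
    ((isCompact_closedBall (0 : Fin 2 → ℝ) 2).prod (isCompact_Icc (a := (1 / 5 : ℝ)) (b := 2 / 3))
      ).tendsto_subseq (x := fun n => (c' (n + N), r' (n + N)))
      fun n => ⟨(hN _ (Nat.le_add_left _ _)).2, hr' _⟩
  have hr₀ : 0 < r₀ := lt_of_lt_of_le (by norm_num) hmem.2.1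
  refine ⟨c₀, r₀, hr₀, fun p hp => (mem_miniset hr₀).2 ⟨by simpa using hM1 hp, ?_⟩⟩
  set ψ : ℕ → ℕ := fun n => φ n + N
  have hψ : Tendsto ψ atTop atTop := (tendsto_add_atTop_nat N).comp hφ.tendsto_atTop
  have hdist : ∀ n : ℕ, ∃ q ∈ miniset cantorSquare (c (ψ n)) (r (ψ n)),
      edist p q ≤ Metric.hausdorffEDist (miniset cantorSquare (c (ψ n)) (r (ψ n))) M
        + ((n : ℝ≥0∞) + 1)⁻¹ := by
    intro n
    obtain ⟨q, hq, hq'⟩ := Metric.exists_edist_lt_of_hausdorffEDist_lt hp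
      (t := miniset cantorSquare (c (ψ n)) (r (ψ n)))
      (r := Metric.hausdorffEDist (miniset cantorSquare (c (ψ n)) (r (ψ n))) M
        + ((n : ℝ≥0∞) + 1)⁻¹) (by
        rw [Metric.hausdorffEDist_comm]
        exact ENNReal.lt_add_right (hN (ψ n) (Nat.le_add_left _ _)).1 (by simp))
    exact ⟨q, hq, hq'.le⟩
  choose q hq hq' using hdist
  have hqlim : Tendsto q atTop (𝓝 p) := by
    rw [tendsto_iff_edist_tendsto_0]
    have h0 : Tendsto (fun n : ℕ => ((n : ℝ≥0∞) + 1)⁻¹) atTop (𝓝 0) := by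
      have := (tendsto_add_atTop_iff_nat 1).2 ENNReal.tendsto_inv_nat_nhds_zero
      simpa using this
    have h1 := (hlim.comp hψ).add h0
    rw [add_zero] at h1
    refine tendsto_of_tendsto_of_tendsto_of_le_of_le tendsto_const_nhds h1 (fun _ => zero_le)
      fun n => ?_
    rw [edist_comm]
    exact hq' n
  have h1 : Tendsto (fun n => c' (ψ n) + r' (ψ n) • q n) atTop (𝓝 (c₀ + r₀ • p)) :=
    ((continuous_fst.tendsto _).comp hconv).add
      (((continuous_snd.tendsto _).comp hconv).smul hqlim)
  exact isCompact_cantorSquare.isClosed.mem_of_tendsto h1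
    (Eventually.of_forall fun n => ((mem_miniset (hr0 _)).1 (hsub _ (hq n))).2)

/-! ### Hausdorff dimension of the Cantor square -/

/-- The `n`-th Cantor digit. -/
noncomputable def cantorDigit (x : ℝ) (n : ℕ) : Fin 2 := firstDigit (expand^[n] x)

theorem expand_iterate_mem_cantorC {x : ℝ} (hx : x ∈ cantorC) (n : ℕ) : expand^[n] x ∈ cantorC := by
  induction n with
  | zero => exact hx
  | succ n ih => rw [Function.iterate_succ_apply']; exact expand_mem_cantorC ih

theorem abs_sub_eq_of_cantorDigit_eq {x y : ℝ} {n : ℕ}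
    (h : ∀ i < n, cantorDigit x i = cantorDigit y i) :
    |x - y| = (6 / 20) ^ n * |expand^[n] x - expand^[n] y| := by
  induction n with
  | zero => simp
  | succ n ih =>
    rw [ih fun i hi => h i (hi.trans n.lt_succ_self), Function.iterate_succ_apply',
      Function.iterate_succ_apply', abs_sub_eq_of_firstDigit_eq (h n n.lt_succ_self), pow_succ]
    ring

theorem eq_of_cantorDigit_eq {x y : ℝ} (hx : x ∈ cantorC) (hy : y ∈ cantorC)
    (h : ∀ n, cantorDigit x n = cantorDigit y n) : x = y := by
  have hle : ∀ n : ℕ, |x - y| ≤ (6 / 20) ^ n := fun n => by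
    rw [abs_sub_eq_of_cantorDigit_eq fun i (_ : i < n) => h i]
    have h1 := cantorC_subset_Icc (expand_iterate_mem_cantorC hx n)
    have h2 := cantorC_subset_Icc (expand_iterate_mem_cantorC hy n)
    have : |expand^[n] x - expand^[n] y| ≤ 1 :=
      abs_le.2 ⟨by linarith [h1.1, h2.2], by linarith [h1.2, h2.1]⟩
    exact mul_le_of_le_one_right (by positivity) this
  have := ge_of_tendsto' (tendsto_pow_atTop_nhds_zero_of_lt_one (by norm_num)
    (show (6 / 20 : ℝ) < 1 by norm_num)) hle
  exact sub_eq_zero.1 (abs_nonpos_iff.1 this)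

theorem le_abs_sub_of_cantorDigit_ne {x y : ℝ} (hx : x ∈ cantorC) (hy : y ∈ cantorC) {n : ℕ}
    (h : ∀ i < n, cantorDigit x i = cantorDigit y i) (hn : cantorDigit x n ≠ cantorDigit y n) :
    2 / 5 * (6 / 20) ^ n ≤ |x - y| := by
  rw [abs_sub_eq_of_cantorDigit_eq h, mul_comm]
  refine mul_le_mul_of_nonneg_left ?_ (by positivity)
  by_contra! hlt
  exact hn (firstDigit_eq_of_abs_sub_lt (expand_iterate_mem_cantorC hx n)
    (expand_iterate_mem_cantorC hy n) hlt)

/-- If the digits first differ at `n`, the binary values are within `2 ^ (-n)`, while the Cantor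
points are at least `2/5 * (6/20) ^ n` apart. The exponent 5/9 works because `(3/10) ^ 5 ≥ (1/2) ^
9`, and the factor 5/2 absorbs the 2/5. -/
theorem abs_ofDigits_cantorDigit_sub_le {x y : ℝ} (hx : x ∈ cantorC) (hy : y ∈ cantorC) :
    |Real.ofDigits (cantorDigit x) - Real.ofDigits (cantorDigit y)| ≤
      5 / 2 * |x - y| ^ (5 / 9 : ℝ) := by
  by_cases hxy : ∃ n, cantorDigit x n ≠ cantorDigit y n
  · classical
    set n := Nat.find hxy
    have hn : cantorDigit x n ≠ cantorDigit y n := Nat.find_spec hxy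
    have hlt : ∀ i < n, cantorDigit x i = cantorDigit y i := fun i hi => by
      simpa using Nat.find_min hxy hi
    have h1 := Real.abs_ofDigits_sub_ofDigits_le hlt
    have h2 := le_abs_sub_of_cantorDigit_ne hx hy hlt hn
    have h3 := Real.rpow_le_rpow (by positivity) h2 (show (0 : ℝ) ≤ 5 / 9 by norm_num)
    have h4 : (1 / 2 : ℝ) ≤ (6 / 20) ^ (5 / 9 : ℝ) := by
      have : ((1 / 2 : ℝ) ^ (9 : ℝ)) ^ (1 / 9 : ℝ) ≤ ((6 / 20 : ℝ) ^ (5 : ℝ)) ^ (1 / 9 : ℝ) :=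
        Real.rpow_le_rpow (by positivity) (by norm_num) (by norm_num)
      rw [← Real.rpow_mul (by norm_num), ← Real.rpow_mul (by norm_num)] at this
      norm_num at this ⊢
      exact this
    have h5 : (2 / 5 : ℝ) ≤ (2 / 5) ^ (5 / 9 : ℝ) := by
      conv_lhs => rw [← Real.rpow_one (2 / 5)]
      exact Real.rpow_le_rpow_of_exponent_ge (by norm_num) (by norm_num) (by norm_num)
    rw [Real.mul_rpow (by norm_num) (by positivity), ← Real.rpow_natCast, ← Real.rpow_mul
      (by norm_num), mul_comm (n : ℝ), Real.rpow_mul (by norm_num), Real.rpow_natCast] at h3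
    have h6 : 2 / 5 * (1 / 2 : ℝ) ^ n ≤ (2 / 5) ^ (5 / 9 : ℝ) * ((6 / 20) ^ (5 / 9 : ℝ)) ^ n := by
      gcongr
    have h7 : (((2 : ℕ) : ℝ) ^ n)⁻¹ = (1 / 2 : ℝ) ^ n := by simp
    rw [h7] at h1
    linarith
  · push Not at hxy
    rw [funext hxy, sub_self, abs_zero]
    positivity

theorem holderOnWith_ofDigits_cantorDigit :
    HolderOnWith (5 / 2) (5 / 9) (fun (p : Fin 2 → ℝ) i => Real.ofDigits (cantorDigit (p i)))
      cantorSquare := by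
  intro p hp q hq
  refine edist_pi_le_iff.2 fun i => ?_
  have h := abs_ofDigits_cantorDigit_sub_le (mem_cantorSquare.1 hp i) (mem_cantorSquare.1 hq i)
  calc edist (Real.ofDigits (cantorDigit (p i))) (Real.ofDigits (cantorDigit (q i)))
      ≤ ENNReal.ofReal (5 / 2 * |p i - q i| ^ (5 / 9 : ℝ)) := by
        rw [edist_dist, Real.dist_eq]; exact ENNReal.ofReal_le_ofReal h
    _ = ((5 / 2 : NNReal) : ℝ≥0∞) * edist (p i) (q i) ^ ((5 / 9 : NNReal) : ℝ) := by
        rw [ENNReal.ofReal_mul (by norm_num), edist_dist, Real.dist_eq,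
          ENNReal.ofReal_rpow_of_nonneg (abs_nonneg _) (by positivity)]
        congr 1
        rw [← ENNReal.ofReal_coe_nnreal]; norm_num
    _ ≤ _ := by gcongr; exact edist_le_pi_edist p q i

/-- The point of the Cantor set with prescribed digits. -/
noncomputable def cantorPoint (e : ℕ → Fin 2) : ℝ := ∑' n, 14 / 20 * ((e n : ℕ) : ℝ) * (6 / 20) ^ n

theorem fin_two_le_one (e : Fin 2) : ((e : ℕ) : ℝ) ≤ 1 := by
  exact_mod_cast Nat.lt_succ_iff.1 e.2

theorem summable_cantorPoint (e : ℕ → Fin 2) :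
    Summable fun n => 14 / 20 * ((e n : ℕ) : ℝ) * (6 / 20) ^ n := by
  refine Summable.of_nonneg_of_le (fun n => by positivity) (fun n => ?_)
    (summable_geometric_of_lt_one (by norm_num) (show (6 / 20 : ℝ) < 1 by norm_num))
  have := fin_two_le_one (e n)
  exact mul_le_of_le_one_left (by positivity) (by linarith)

theorem cantorPoint_eq_branch (e : ℕ → Fin 2) :
    cantorPoint e = branch (e 0) (cantorPoint fun n => e (n + 1)) := by
  rw [cantorPoint, (summable_cantorPoint e).tsum_eq_zero_add, branch, cantorPoint, ← tsum_mul_left]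
  simp only [pow_zero, mul_one, pow_succ]
  congr 2
  ext n
  ring

theorem cantorPoint_mem_Icc (e : ℕ → Fin 2) : cantorPoint e ∈ Icc (0 : ℝ) 1 := by
  refine ⟨tsum_nonneg fun n => by positivity, ?_⟩
  have h : HasSum (fun n : ℕ => 14 / 20 * (6 / 20 : ℝ) ^ n) (14 / 20 * (1 - 6 / 20)⁻¹) :=
    (hasSum_geometric_of_lt_one (by norm_num) (by norm_num)).mul_left _
  refine ((summable_cantorPoint e).tsum_le_tsum (fun n => ?_) h.summable).trans
    (h.tsum_eq.trans_le (by norm_num))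
  have := fin_two_le_one (e n)
  have h0 : (0 : ℝ) ≤ (6 / 20) ^ n := by positivity
  nlinarith

theorem cantorPoint_mem_cantorC (e : ℕ → Fin 2) : cantorPoint e ∈ cantorC := by
  refine mem_iInter.2 fun n => ?_
  induction n generalizing e with
  | zero => exact cantorPoint_mem_Icc e
  | succ n ih => rw [cantorPoint_eq_branch]; exact branch_mem_preCantor _ (ih _)

theorem expand_iterate_cantorPoint (e : ℕ → Fin 2) (n : ℕ) :
    expand^[n] (cantorPoint e) = cantorPoint fun i => e (i + n) := by
  induction n with
  | zero => rfl
  | succ n ih =>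
    rw [Function.iterate_succ_apply', ih, cantorPoint_eq_branch,
      expand_branch _ (cantorPoint_mem_Icc _)]
    simp only [add_right_comm, add_assoc]

theorem cantorDigit_cantorPoint (e : ℕ → Fin 2) : cantorDigit (cantorPoint e) = e := by
  ext n
  rw [cantorDigit, expand_iterate_cantorPoint, cantorPoint_eq_branch,
    firstDigit_branch _ (cantorPoint_mem_Icc _), zero_add]

theorem Icc_subset_image_ofDigits_cantorDigit :
    Icc 0 1 ⊆ (fun (p : Fin 2 → ℝ) i => Real.ofDigits (cantorDigit (p i))) '' cantorSquare := by
  intro q hq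
  have h : ∀ i, ∃ e : ℕ → Fin 2, Real.ofDigits e = q i := fun i => by
    obtain ⟨e, -, he⟩ := Real.ofDigits_SurjOn (b := 2) (by norm_num) ⟨hq.1 i, hq.2 i⟩
    exact ⟨e, he⟩
  choose e he using h
  refine ⟨fun i => cantorPoint (e i), mem_cantorSquare.2 fun i => cantorPoint_mem_cantorC _, ?_⟩
  ext i
  simp only [cantorDigit_cantorPoint, he]

/-- The Hölder image contains a square of dimension 2, so `2 ≤ dimH cantorSquare / (5/9)`; a
dimension of at most 1 would contradict `2 * (5/9) > 1`. -/
theorem one_lt_dimH_cantorSquare : 1 < dimH cantorSquare := by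
  have h1 := holderOnWith_ofDigits_cantorDigit.dimH_image_le (by norm_num)
  have h2 : dimH (Icc (0 : Fin 2 → ℝ) 1) = 2 := by
    rw [Real.dimH_of_nonempty_interior]
    · simp
    · rw [← pi_univ_Icc, interior_pi_set finite_univ]
      exact ⟨fun _ => 1 / 2, fun i _ => by simp; norm_num⟩
  have h3 := h2 ▸ (dimH_mono Icc_subset_image_ofDigits_cantorDigit).trans h1
  by_contra! hle
  have h4 : (2 : ℝ≥0∞) ≤ 1 / ((5 / 9 : NNReal) : ℝ≥0∞) := h3.trans (by gcongr)
  rw [ENNReal.le_div_iff_mul_le (by simp) (by simp)] at h4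
  have h5 : ((2 * (5 / 9) : NNReal) : ℝ≥0∞) ≤ ((1 : NNReal) : ℝ≥0∞) := by simpa using h4
  rw [ENNReal.coe_le_coe, ← NNReal.coe_le_coe] at h5
  norm_num at h5

/-! ### A smooth function that is injective on the Cantor square -/

/-- Cantor points closer than `2/5 * (6/20) ^ n` share their digits up to index `n`, so prescribing
one digit is a closed condition. -/
theorem isCompact_cantorDigit_eq (n : ℕ) (e : Fin 2) :
    IsCompact {x | x ∈ cantorC ∧ cantorDigit x n = e} := by
  refine isCompact_cantorC.of_isClosed_subset (isClosed_of_closure_subset fun x hx => ?_)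
    fun x hx => hx.1
  have hxC : x ∈ cantorC :=
    isCompact_cantorC.isClosed.closure_subset_iff.2 (fun y hy => hy.1) hx
  obtain ⟨y, hy, hxy⟩ := Metric.mem_closure_iff.1 hx (2 / 5 * (6 / 20) ^ n) (by positivity)
  refine ⟨hxC, ?_⟩
  by_contra hne
  have hne' : ∃ m, cantorDigit x m ≠ cantorDigit y m := ⟨n, by rwa [hy.2]⟩
  classical
  have h1 := le_abs_sub_of_cantorDigit_ne hxC hy.1
    (fun i hi => by simpa using Nat.find_min hne' hi) (Nat.find_spec hne')
  have h2 : Nat.find hne' ≤ n := Nat.find_le (by rwa [hy.2])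
  have h3 : (6 / 20 : ℝ) ^ n ≤ (6 / 20) ^ Nat.find hne' :=
    pow_le_pow_of_le_one (by norm_num) (by norm_num) h2
  rw [Real.dist_eq] at hxy
  linarith

/-- The two level sets of a digit are disjoint and closed, so a smooth Urysohn function separates
them. -/
theorem exists_contDiff_eq_cantorDigit (i : Fin 2) (n : ℕ) :
    ∃ F : (Fin 2 → ℝ) → ℝ, ContDiff ℝ ∞ F ∧ HasCompactSupport F ∧
      ∀ p ∈ cantorSquare, F p = ((cantorDigit (p i) n : ℕ) : ℝ) := by
  have hcl : ∀ e, IsClosed {p | p ∈ cantorSquare ∧ cantorDigit (p i) n = e} := fun e => by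
    have : {p | p ∈ cantorSquare ∧ cantorDigit (p i) n = e} = cantorSquare ∩
        (fun p : Fin 2 → ℝ => p i) ⁻¹' {x | x ∈ cantorC ∧ cantorDigit x n = e} := by
      ext p
      simp only [mem_inter_iff, mem_preimage, mem_ofPred_eq]
      exact ⟨fun h => ⟨h.1, mem_cantorSquare.1 h.1 i, h.2⟩, fun h => ⟨h.1, h.2.2⟩⟩
    rw [this]
    exact isCompact_cantorSquare.isClosed.inter
      ((isCompact_cantorDigit_eq n e).isClosed.preimage (continuous_apply i))
  have hball : ∀ p ∈ cantorSquare, ‖p‖ < 2 := fun p hp => by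
    refine ((pi_norm_le_iff_of_nonneg zero_le_one).2 fun j => ?_).trans_lt one_lt_two
    have := cantorC_subset_Icc (mem_cantorSquare.1 hp j)
    rw [Real.norm_eq_abs, abs_le]
    exact ⟨by linarith [this.1], this.2⟩
  -- Adding the region of norm at least 2 to the zero set gives compact support, hence bounded
  -- derivatives of every order.
  obtain ⟨F, h0, h1, -⟩ := exists_contMDiffMap_zero_one_of_isClosed (n := ⊤)
    (modelWithCornersSelf ℝ (Fin 2 → ℝ))
    ((hcl 0).union (isClosed_le continuous_const continuous_norm :
      IsClosed {p : Fin 2 → ℝ | 2 ≤ ‖p‖})) (hcl 1) (by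
      rw [Set.disjoint_left]
      rintro p (hp | hp) hp'
      · exact absurd (hp.2.symm.trans hp'.2) (by decide)
      · exact absurd hp (not_le.2 (hball p hp'.1)))
  refine ⟨F, F.contMDiff.contDiff, ?_, fun p hp => ?_⟩
  · refine HasCompactSupport.intro (isCompact_closedBall 0 2) fun p hp => h0 (Or.inr ?_)
    rw [mem_closedBall_zero_iff, not_le] at hp
    exact hp.le
  · rcases Fin.eq_zero_or_eq_succ (cantorDigit (p i) n) with h | ⟨j, h⟩
    · rw [h]; simpa using h0 (Or.inl ⟨hp, h⟩)
    · have : cantorDigit (p i) n = 1 := by rw [h]; fin_cases j; rfl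
      rw [this]; simpa using h1 ⟨hp, this⟩

/-- A sequence of compactly supported smooth functions can be summed with rapidly decreasing
positive weights. -/
theorem exists_contDiff_tsum_smul {E : Type*} [NormedAddCommGroup E] [NormedSpace ℝ E]
    (F : ℕ → E → ℝ) (hF : ∀ n, ContDiff ℝ ∞ (F n)) (hc : ∀ n, HasCompactSupport (F n)) :
    ∃ r : ℕ → ℝ, (∀ n, 0 < r n) ∧ (∀ n, r (n + 1) ≤ r n / 3) ∧
      ContDiff ℝ ∞ fun x => ∑' n, r n * F n x := by
  -- A diagonal choice: `M n` controls only the derivatives of `F n` of order at most `n`. For a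
  -- fixed order `k` this covers all but finitely many terms, which is enough for differentiating
  -- the series.
  have h : ∀ n, ∃ M : ℝ, 1 ≤ M ∧ ∀ k ≤ n, ∀ x, ‖iteratedFDeriv ℝ k (F n) x‖ ≤ M := fun n => by
    have h1 : ∀ k, ∃ R, ∀ x, ‖iteratedFDeriv ℝ k (F n) x‖ ≤ R := fun k => by
      have : BddAbove (range fun x => ‖iteratedFDeriv ℝ k (F n) x‖) :=
        Continuous.bddAbove_range_of_hasCompactSupport
          ((hF n).continuous_iteratedFDeriv (mod_cast le_top)).norm (((hc n).iteratedFDeriv k).comp_left norm_zero)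
      obtain ⟨R, hR⟩ := this
      exact ⟨R, fun x => hR (mem_range_self x)⟩
    choose R hR using h1
    refine ⟨1 + ∑ k ∈ Finset.range (n + 1), |R k|, ?_, fun k hk x => (hR k x).trans ?_⟩
    · have := Finset.sum_nonneg fun k (_ : k ∈ Finset.range (n + 1)) => abs_nonneg (R k)
      linarith
    · have := Finset.single_le_sum (f := fun k => |R k|) (fun k _ => abs_nonneg (R k))
        (Finset.mem_range.2 (Nat.lt_succ_of_le hk))
      linarith [le_abs_self (R k)]
  choose M hM1 hM using h
  have hM0 : ∀ n, 0 < M n := fun n => one_pos.trans_le (hM1 n)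
  set r : ℕ → ℝ := fun n => ∏ i ∈ Finset.range (n + 1), (3 * M i)⁻¹ with hr
  have hr0 : ∀ n, 0 < r n := fun n => Finset.prod_pos fun i _ => by have := hM0 i; positivity
  have hsucc : ∀ n, r (n + 1) = r n * (3 * M (n + 1))⁻¹ := fun n => Finset.prod_range_succ _ _
  have hM3 : ∀ n, (3 * M n)⁻¹ ≤ 3⁻¹ := fun n =>
    inv_anti₀ (by norm_num) (by linarith [hM1 n])
  have hrM : ∀ n, r n * M n ≤ (1 / 3) ^ n := fun n => by
    have h1 : r n * M n = (∏ i ∈ Finset.range n, (3 * M i)⁻¹) * 3⁻¹ := by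
      rw [hr]
      simp only [Finset.prod_range_succ]
      have := (hM0 n).ne'
      field_simp
    have h2 : (∏ i ∈ Finset.range n, (3 * M i)⁻¹) ≤ ∏ i ∈ Finset.range n, (1 / 3 : ℝ) :=
      Finset.prod_le_prod (fun i _ => by have := hM0 i; positivity) fun i _ => by
        rw [one_div]; exact hM3 i
    rw [Finset.prod_const, Finset.card_range] at h2
    have h3 : (0 : ℝ) ≤ (1 / 3) ^ n := by positivity
    rw [h1]; linarith
  refine ⟨r, hr0, fun n => ?_, ?_⟩
  · rw [hsucc, div_eq_mul_inv]
    exact mul_le_mul_of_nonneg_left (hM3 _) (hr0 n).le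
  · refine contDiff_tsum_of_eventually (v := fun _ n => (1 / 3 : ℝ) ^ n)
      (fun n => contDiff_const.mul (hF n))
      (fun _ _ => summable_geometric_of_lt_one (by norm_num) (by norm_num)) fun k _ => ?_
    rw [Nat.cofinite_eq_atTop]
    filter_upwards [eventually_ge_atTop k] with n hn x
    have h1 : iteratedFDeriv ℝ k (fun x => r n * F n x) x = r n • iteratedFDeriv ℝ k (F n) x :=
      iteratedFDeriv_const_smul_apply (a := r n)
        (((hF n).of_le (mod_cast le_top)).contDiffAt)
    rw [h1, norm_smul, Real.norm_of_nonneg (hr0 n).le]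
    exact (mul_le_mul_of_nonneg_left (hM n k hn x) (hr0 n).le).trans (hrM n)

/-- The first nonzero term of a rapidly decreasing series dominates the sum of the others. -/
theorem tsum_mul_ne_zero_of_rapidly_decreasing {r a : ℕ → ℝ} (hr0 : ∀ n, 0 < r n)
    (hr : ∀ n, r (n + 1) ≤ r n / 3) (ha : ∀ n, |a n| ≤ 1) {m : ℕ} (hlt : ∀ n < m, a n = 0)
    (hm : |a m| = 1) : Summable (fun n => r n * a n) ∧ ∑' n, r n * a n ≠ 0 := by
  have hpow : ∀ k n, r (n + k) ≤ r n * (1 / 3) ^ k := fun k n => by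
    induction k with
    | zero => simp
    | succ k ih => rw [← add_assoc, pow_succ]; linarith [hr (n + k)]
  have hbound : ∀ n, ‖r n * a n‖ ≤ r 0 * (1 / 3) ^ n := fun n => by
    rw [norm_mul, Real.norm_of_nonneg (hr0 n).le, Real.norm_eq_abs]
    have h1 := hpow n 0
    rw [zero_add] at h1
    exact (mul_le_of_le_one_right (hr0 n).le (ha n)).trans h1
  have hgeo : Summable fun n : ℕ => (1 / 3 : ℝ) ^ n :=
    summable_geometric_of_lt_one (by norm_num) (by norm_num)
  have hs : Summable fun n => r n * a n := Summable.of_norm_bounded (hgeo.mul_left _) hbound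
  refine ⟨hs, fun h0 => ?_⟩
  rw [← hs.sum_add_tsum_nat_add (m + 1), Finset.sum_range_succ,
    Finset.sum_eq_zero fun i hi => by rw [hlt i (Finset.mem_range.1 hi), mul_zero], zero_add] at h0
  -- The tail is at most `3/2 * r (m + 1) ≤ r m / 2`, too small to cancel the term of index `m`.
  have htail : ‖∑' n, r (n + (m + 1)) * a (n + (m + 1))‖ ≤ r (m + 1) * (1 - 1 / 3)⁻¹ := by
    refine tsum_of_norm_bounded ((hasSum_geometric_of_lt_one (by norm_num)
      (by norm_num)).mul_left (r (m + 1))) fun n => ?_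
    rw [norm_mul, Real.norm_of_nonneg (hr0 _).le, Real.norm_eq_abs, add_comm n]
    exact (mul_le_of_le_one_right (hr0 _).le (ha _)).trans (hpow n (m + 1))
  have h1 : ‖r m * a m‖ = r m := by
    rw [norm_mul, Real.norm_of_nonneg (hr0 m).le, Real.norm_eq_abs, hm, mul_one]
  rw [eq_neg_of_add_eq_zero_left h0, norm_neg] at h1
  rw [h1] at htail
  have := hr m
  have := hr0 m
  norm_num at htail
  linarith

/-- With all pairs (coordinate, digit index) enumerated by `e`, distinct points differ in some
digit; the first difference is ±1 and dominates all later ones. -/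
theorem exists_contDiff_injOn_cantorSquare :
    ∃ f : (Fin 2 → ℝ) → ℝ, ContDiff ℝ ∞ f ∧ InjOn f cantorSquare := by
  obtain ⟨e⟩ : Nonempty (ℕ ≃ Fin 2 × ℕ) := nonempty_equiv_of_countable
  choose F hF hc hFd using fun n => exists_contDiff_eq_cantorDigit (e n).1 (e n).2
  obtain ⟨r, hr0, hr, hf⟩ := exists_contDiff_tsum_smul F hF hc
  refine ⟨_, hf, fun p hp q hq hpq => ?_⟩
  by_contra hne
  have hdiff : ∃ n, F n p ≠ F n q := by
    by_contra! hall
    refine hne (funext fun i => eq_of_cantorDigit_eq (mem_cantorSquare.1 hp i)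
      (mem_cantorSquare.1 hq i) fun k => ?_)
    have := hall (e.symm (i, k))
    rw [hFd _ p hp, hFd _ q hq] at this
    simpa [Fin.val_inj] using this
  classical
  have hval : ∀ n, |F n p - F n q| ≤ 1 ∧ (F n p ≠ F n q → |F n p - F n q| = 1) := fun n => by
    rw [hFd _ p hp, hFd _ q hq]
    generalize cantorDigit (p (e n).1) (e n).2 = a
    generalize cantorDigit (q (e n).1) (e n).2 = b
    fin_cases a <;> fin_cases b <;> simp
  obtain ⟨hs, hsum⟩ := tsum_mul_ne_zero_of_rapidly_decreasing hr0 hr (fun n => (hval n).1)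
    (m := Nat.find hdiff) (fun n hn => sub_eq_zero.2 (by simpa using Nat.find_min hdiff hn))
    ((hval _).2 (Nat.find_spec hdiff))
  have hsF : ∀ p ∈ cantorSquare, Summable fun n => r n * F n p := fun p hp => by
    have hpow : ∀ n, r n ≤ r 0 * (1 / 3) ^ n := fun n => by
      induction n with
      | zero => simp
      | succ k ih => rw [pow_succ]; linarith [hr k]
    refine Summable.of_nonneg_of_le (fun n => ?_) (fun n => ?_)
      ((summable_geometric_of_lt_one (by norm_num) (show (1 / 3 : ℝ) < 1 by norm_num)).mul_left
        (r 0))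
    · rw [hFd n p hp]; exact mul_nonneg (hr0 n).le (Nat.cast_nonneg _)
    · rw [hFd n p hp]
      exact (mul_le_of_le_one_right (hr0 n).le (fin_two_le_one _)).trans (hpow n)
  apply hsum
  simp only [mul_sub]
  rw [(hsF p hp).tsum_sub (hsF q hq)]
  exact sub_eq_zero.2 hpq

theorem exists_contDiff_injOn_dimH_lt :
    ∃ f : (Fin 2 → ℝ) → ℝ, ContDiff ℝ ∞ f ∧ InjOn f cantorSquare ∧
      dimH (f '' cantorSquare) < dimH cantorSquare ∧
      ∀ y ∈ f '' cantorSquare,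
        dimH (f '' cantorSquare) + dimH (cantorSquare ∩ f ⁻¹' {y}) < dimH cantorSquare := by
  obtain ⟨f, hf, hinj⟩ := exists_contDiff_injOn_cantorSquare
  have h1 : dimH (f '' cantorSquare) < dimH cantorSquare :=
    ((dimH_mono (subset_univ _)).trans_eq Real.dimH_univ).trans_lt one_lt_dimH_cantorSquare
  refine ⟨f, hf, hinj, h1, fun y _ => ?_⟩
  rw [dimH_subsingleton (s := cantorSquare ∩ f ⁻¹' {y}), add_zero]
  · exact h1
  · exact fun p hp q hq => hinj hp.1 hq.1 (hp.2.trans hq.2.symm)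

/-! ### The fractal distribution of Lebesgue measure -/

/-- A locally finite measure on `ℝ^d` is a measurable point of the space of measures. -/
theorem measurableSet_eq_measure {d : ℕ} (L : Measure (Fin d → ℝ)) [IsLocallyFiniteMeasure L] :
    MeasurableSet {ν : Measure (Fin d → ℝ) | ν = L} := by
  -- Boxes with rational endpoints form a countable π-system generating the Borel sets, so equality
  -- with `L` amounts to countably many measurable conditions.
  set C : Fin d → Set (Set ℝ) := fun _ => ⋃ (a : ℚ) (b : ℚ) (_ : a < b), {Ioo (a : ℝ) (b : ℝ)}
  have hCc : ∀ i, (C i).Countable := fun i =>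
    countable_iUnion fun a => countable_iUnion fun b => countable_iUnion fun _ =>
      countable_singleton _
  have hmem : ∀ i (n : ℕ), Ioo (-(n + 1) : ℝ) (n + 1) ∈ C i := fun i n => by
    simp only [C, mem_iUnion, mem_singleton_iff]
    exact ⟨-(n + 1), n + 1, by linarith [(Nat.cast_nonneg n : (0 : ℚ) ≤ n)], by push_cast; rfl⟩
  have hpi : IsPiSystem (pi univ '' pi univ C) := IsPiSystem.pi fun _ => Real.isPiSystem_Ioo_rat
  have hgen : (MeasurableSpace.pi : MeasurableSpace (Fin d → ℝ)) =
      MeasurableSpace.generateFrom (pi univ '' pi univ C) := by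
    rw [← generateFrom_pi_eq fun i => ⟨fun n => Ioo (-(n + 1) : ℝ) (n + 1), hmem i, ?_⟩]
    · have : MeasurableSpace.generateFrom (⋃ (a : ℚ) (b : ℚ) (_ : a < b), {Ioo (a : ℝ) (b : ℝ)}) =
          borel ℝ := Real.borel_eq_generateFrom_Ioo_rat.symm
      rw [← BorelSpace.measurable_eq] at this
      exact congrArg (fun m => @MeasurableSpace.pi (Fin d) (fun _ => ℝ) fun _ => m) this.symm
    · refine iUnion_eq_univ_iff.2 fun x => ?_
      obtain ⟨n, hn⟩ := exists_nat_gt |x|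
      exact ⟨n, by linarith [(abs_lt.1 hn).1], by linarith [(abs_lt.1 hn).2]⟩
  have hmeas : ∀ B ∈ pi univ '' pi univ C, MeasurableSet B := fun B hB => by
    rw [hgen]; exact MeasurableSpace.measurableSet_generateFrom hB
  have hcount : (pi univ '' pi univ C).Countable := (countable_univ_pi hCc).image _
  have heq : {ν : Measure (Fin d → ℝ) | ν = L} =
      ⋂ B ∈ pi univ '' pi univ C, {ν : Measure (Fin d → ℝ) | ν B = L B} := by
    ext ν
    simp only [mem_ofPred_eq, mem_iInter]
    refine ⟨fun h B _ => by rw [h], fun h => ?_⟩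
    refine Measure.ext_of_generateFrom_of_iUnion _
      (fun n : ℕ => univ.pi fun _ => Ioo (-(n + 1) : ℝ) (n + 1)) hgen hpi ?_
      (fun n => ⟨_, fun i _ => hmem i n, rfl⟩) (fun n => ?_) h
    · refine iUnion_eq_univ_iff.2 fun x => ?_
      obtain ⟨n, hn⟩ := exists_nat_gt ‖x‖
      refine ⟨n, fun i _ => ?_⟩
      have := abs_lt.1 ((norm_le_pi_norm x i).trans_lt hn)
      exact ⟨by linarith [this.1], by linarith [this.2]⟩
    · rw [h _ ⟨_, fun i _ => hmem i n, rfl⟩]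
      exact (Bornology.IsBounded.pi fun _ => Metric.isBounded_Ioo _ _).measure_lt_top.ne
  rw [heq]
  exact MeasurableSet.biInter hcount fun B hB =>
    measurableSet_eq_fun (Measure.measurable_coe (hmeas B hB)) measurable_const

theorem measurable_starNorm {d : ℕ} :
    Measurable (starNorm : Measure (Fin d → ℝ) → Measure (Fin d → ℝ)) := by
  refine Measure.measurable_of_measurable_coe _ fun s hs => ?_
  simp only [starNorm, Measure.smul_apply, smul_eq_mul]
  exact (Measure.measurable_coe Metric.isClosed_closedBall.measurableSet).inv.mul
    (Measure.measurable_coe hs)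

theorem starNorm_smul {d : ℕ} {c : ℝ≥0∞} (h0 : c ≠ 0) (hc : c ≠ ⊤) (ν : Measure (Fin d → ℝ)) :
    starNorm (c • ν) = starNorm ν := by
  rw [starNorm, starNorm, Measure.smul_apply, smul_eq_mul, smul_smul,
    ENNReal.mul_inv (Or.inl h0) (Or.inl hc), mul_right_comm, ENNReal.inv_mul_cancel h0 hc, one_mul]

/-- Lebesgue measure normalized to give mass one to the unit ball. -/
noncomputable def normLebesgue (d : ℕ) : Measure (Fin d → ℝ) :=
  (volume (Metric.closedBall (0 : Fin d → ℝ) 1))⁻¹ • volume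

theorem volume_unitBall_ne_zero (d : ℕ) :
    volume (Metric.closedBall (0 : Fin d → ℝ) 1) ≠ 0 :=
  (Metric.measure_closedBall_pos _ _ one_pos).ne'

theorem volume_unitBall_ne_top (d : ℕ) :
    volume (Metric.closedBall (0 : Fin d → ℝ) 1) ≠ ⊤ :=
  measure_closedBall_lt_top.ne

theorem inv_volume_unitBall_ne_zero (d : ℕ) :
    (volume (Metric.closedBall (0 : Fin d → ℝ) 1))⁻¹ ≠ 0 :=
  ENNReal.inv_ne_zero.2 (volume_unitBall_ne_top d)

theorem inv_volume_unitBall_ne_top (d : ℕ) :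
    (volume (Metric.closedBall (0 : Fin d → ℝ) 1))⁻¹ ≠ ⊤ :=
  ENNReal.inv_ne_top.2 (volume_unitBall_ne_zero d)

instance isLocallyFiniteMeasure_normLebesgue (d : ℕ) :
    IsLocallyFiniteMeasure (normLebesgue d) := by
  rw [normLebesgue]
  lift (volume (Metric.closedBall (0 : Fin d → ℝ) 1))⁻¹ to NNReal using
    inv_volume_unitBall_ne_top d with c
  exact inferInstanceAs (IsLocallyFiniteMeasure (c • volume))

instance isOpenPosMeasure_normLebesgue (d : ℕ) : (normLebesgue d).IsOpenPosMeasure :=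
  Measure.isOpenPosMeasure_smul _ (inv_volume_unitBall_ne_zero d)

theorem normLebesgue_unitBall (d : ℕ) : normLebesgue d (Metric.closedBall 0 1) = 1 := by
  rw [normLebesgue, Measure.smul_apply, smul_eq_mul,
    ENNReal.inv_mul_cancel (volume_unitBall_ne_zero d) (volume_unitBall_ne_top d)]

theorem starNorm_scaleMeas_normLebesgue {d : ℕ} (t : ℝ) :
    starNorm (scaleMeas t (normLebesgue d)) = normLebesgue d := by
  rw [normLebesgue, scaleMeas, Measure.map_smul,
    Measure.map_addHaar_smul volume (Real.exp_ne_zero t), starNorm_smul, starNorm_smul, starNorm]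
  · simp only [ne_eq, ENNReal.ofReal_eq_zero, not_le]
    positivity
  · exact ENNReal.ofReal_ne_top
  · exact inv_volume_unitBall_ne_zero d
  · exact inv_volume_unitBall_ne_top d

theorem starNorm_translateMeas_normLebesgue {d : ℕ} (x : Fin d → ℝ) :
    starNorm (translateMeas x (normLebesgue d)) = normLebesgue d := by
  rw [normLebesgue, translateMeas, Measure.map_smul,
    (measurePreserving_sub_right volume x).map_eq, starNorm_smul, starNorm]
  · exact inv_volume_unitBall_ne_zero d
  · exact inv_volume_unitBall_ne_top d

/-- The point mass at normalized Lebesgue measure. -/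
noncomputable def lebesgueEFD (d : ℕ) : Measure (Measure (Fin d → ℝ)) :=
  Measure.dirac (normLebesgue d)

instance isProbabilityMeasure_lebesgueEFD (d : ℕ) : IsProbabilityMeasure (lebesgueEFD d) :=
  inferInstanceAs (IsProbabilityMeasure (Measure.dirac (normLebesgue d)))

theorem ae_lebesgueEFD_eq (d : ℕ) : ∀ᵐ ν ∂lebesgueEFD d, ν = normLebesgue d :=
  (ae_dirac_iff (measurableSet_eq_measure _)).2 rfl

theorem ae_lebesgueEFD_iff {d : ℕ} {p : Measure (Fin d → ℝ) → Prop} :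
    (∀ᵐ ν ∂lebesgueEFD d, p ν) ↔ p (normLebesgue d) := by
  refine ⟨fun h => ?_, fun h => (ae_lebesgueEFD_eq d).mono fun ν hν => hν ▸ h⟩
  obtain ⟨ν, h1, rfl⟩ := (h.and (ae_lebesgueEFD_eq d)).exists
  exact h1

/-- A point mass is trivially ergodic, and it is invariant because its atom is fixed by the flow.
For the quasi-Palm property, the atom is also fixed by normalized translations, so both sides say
that it lies outside `A`. -/
theorem isEFD_lebesgueEFD (d : ℕ) : IsEFD (lebesgueEFD d) := by
  refine ⟨⟨⟨inferInstance, ae_lebesgueEFD_iff.2 ⟨inferInstance, normLebesgue_unitBall d, ?_⟩⟩,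
    fun t => ⟨?_, ?_⟩, fun U hU _ h0 A hA => ?_⟩, fun A hA _ => ?_⟩
  · rw [Measure.support_eq_univ]; trivial
  · exact measurable_starNorm.comp (Measure.measurable_map _ (by fun_prop))
  · rw [lebesgueEFD, Measure.map_dirac', starNorm_scaleMeas_normLebesgue]
    exact measurable_starNorm.comp (Measure.measurable_map _ (by fun_prop))
  · have h1 : lebesgueEFD d A = 0 ↔ normLebesgue d ∉ A := by
      rw [lebesgueEFD, Measure.dirac_apply' _ hA]
      simp
    rw [h1, ae_lebesgueEFD_iff]
    simp only [starNorm_translateMeas_normLebesgue]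
    refine ⟨fun h => Eventually.of_forall fun _ => h, fun h => ?_⟩
    -- `U` is nonempty and open, hence of positive mass, so a statement independent of `x` can be
    -- read off from its holding almost everywhere.
    have : (ae ((normLebesgue d).restrict U)).NeBot := by
      rw [ae_neBot, Ne, Measure.restrict_eq_zero]
      exact (hU.measure_pos _ ⟨0, h0⟩).ne'
    exact h.exists.choose_spec
  · rw [lebesgueEFD, Measure.dirac_apply' _ hA]
    by_cases h : normLebesgue d ∈ A <;> simp [h]

theorem hasExactDim_normLebesgue (d : ℕ) : HasExactDim (normLebesgue d) d := by
  refine Eventually.of_forall fun x => ?_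
  refine tendsto_const_nhds.congr' ?_
  filter_upwards [Ioo_mem_nhdsGT (zero_lt_one' ℝ)] with r hr
  have h1 : (normLebesgue d).real (Metric.closedBall x r) = r ^ d := by
    rw [normLebesgue, measureReal_ennreal_smul_apply, measureReal_def,
      Real.volume_pi_closedBall _ zero_le_one, Real.volume_pi_closedBall _ hr.1.le,
      Fintype.card_fin, ENNReal.toReal_inv, ENNReal.toReal_ofReal (by positivity),
      ENNReal.toReal_ofReal (by have := hr.1; positivity), mul_one, mul_pow]
    field_simp
  rw [localDimQuot, h1, Real.log_pow, mul_div_assoc, div_self, mul_one]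
  exact (Real.log_neg hr.1 hr.2).ne

theorem integral_lebesgueEFD {d : ℕ} (F : Measure (Fin d → ℝ) → ℝ) :
    ∫ ν, F ν ∂lebesgueEFD d = F (normLebesgue d) := by
  rw [integral_congr_ae ((ae_lebesgueEFD_eq d).mono fun ν hν => congrArg F hν)]
  simp

/-! ### Binary expansions -/

/-- The integer with the first `n` binary digits of a sequence. -/
def trunc (a : ℕ → Fin 2) : ℕ → ℕ
  | 0 => 0
  | n + 1 => 2 * trunc a n + (a n : ℕ)

theorem trunc_eq_iff {a b : ℕ → Fin 2} {n : ℕ} :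
    trunc a n = trunc b n ↔ ∀ i < n, a i = b i := by
  induction n with
  | zero => simp [trunc]
  | succ n ih =>
    simp only [trunc, Nat.lt_succ_iff_lt_or_eq, or_imp, forall_and, forall_eq, Fin.ext_iff] at ih ⊢
    rw [← ih]
    have := (a n).2
    have := (b n).2
    omega

theorem exists_trunc_eq {n u : ℕ} (hu : u < 2 ^ n) : ∃ a, trunc a n = u := by
  induction n generalizing u with
  | zero => exact ⟨0, by simpa [trunc, eq_comm] using hu⟩
  | succ n ih =>
    obtain ⟨a, ha⟩ := ih (u := u / 2) (by rw [pow_succ] at hu; omega)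
    refine ⟨Function.update a n ⟨u % 2, Nat.mod_lt _ two_pos⟩, ?_⟩
    have h : trunc (Function.update a n ⟨u % 2, Nat.mod_lt _ two_pos⟩) n = trunc a n :=
      trunc_eq_iff.2 fun i hi => by simp [hi.ne]
    simp only [trunc, h, ha, Function.update_self]
    omega

theorem trunc_add (a : ℕ → Fin 2) (p k : ℕ) :
    trunc a (p + k) = trunc a p * 2 ^ k + trunc (fun i => a (i + p)) k := by
  induction k with
  | zero => simp [trunc]
  | succ k ih => rw [← add_assoc, trunc, ih, trunc, pow_succ, add_comm k p]; ring

theorem ofDigits_eq_trunc (a : ℕ → Fin 2) (n : ℕ) :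
    Real.ofDigits a * 2 ^ n = trunc a n + Real.ofDigits fun i => a (i + n) := by
  induction n with
  | zero => simp [trunc]
  | succ n ih =>
    have h := Real.ofDigits_eq_sum_add_ofDigits (fun i => a (i + n)) 1
    simp only [Finset.range_one, Finset.sum_singleton, Real.ofDigitsTerm, zero_add, pow_one,
      Nat.cast_ofNat, add_assoc, add_comm 1 n] at h
    rw [pow_succ, ← mul_assoc, ih, h, trunc]
    push_cast
    ring

theorem trunc_le_ofDigits (a : ℕ → Fin 2) (n : ℕ) : (trunc a n : ℝ) ≤ Real.ofDigits a * 2 ^ n := by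
  rw [ofDigits_eq_trunc]
  linarith [Real.ofDigits_nonneg fun i => a (i + n)]

theorem ofDigits_le_trunc_add_one (a : ℕ → Fin 2) (n : ℕ) :
    Real.ofDigits a * 2 ^ n ≤ trunc a n + 1 := by
  rw [ofDigits_eq_trunc]
  linarith [Real.ofDigits_le_one fun i => a (i + n)]

theorem inv_pow_le_ofDigits {a : ℕ → Fin 2} {i k : ℕ} (hi : i < k) (ha : a i = 1) :
    ((2 : ℝ) ^ k)⁻¹ ≤ Real.ofDigits a := by
  have h1 := Real.summable_ofDigitsTerm.le_tsum i fun j (_ : j ≠ i) =>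
    Real.ofDigitsTerm_nonneg (digits := a) (n := j)
  refine le_trans ?_ h1
  simp only [Real.ofDigitsTerm, ha, Fin.val_one, Nat.cast_one, one_mul, Nat.cast_ofNat]
  exact inv_anti₀ (by positivity) (pow_le_pow_right₀ one_le_two hi)

/-- Flipping every binary digit reflects the unit interval; this turns lower bounds for binary
values into upper bounds. -/
theorem ofDigits_add_ofDigits_rev (a : ℕ → Fin 2) :
    Real.ofDigits a + Real.ofDigits (fun i => (a i).rev) = 1 := by
  rw [Real.ofDigits, Real.ofDigits,
    ← Real.summable_ofDigitsTerm.tsum_add Real.summable_ofDigitsTerm,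
    ← Real.ofDigits_const_last_eq_one 1, Real.ofDigits]
  congr 1
  ext i
  simp only [Real.ofDigitsTerm]
  generalize a i = e
  fin_cases e <;> simp [Fin.rev]

theorem ofDigits_le_one_sub {a : ℕ → Fin 2} {i k : ℕ} (hi : i < k) (ha : a i = 0) :
    Real.ofDigits a ≤ 1 - ((2 : ℝ) ^ k)⁻¹ := by
  have h1 := ofDigits_add_ofDigits_rev a
  have h2 := inv_pow_le_ofDigits (a := fun i => (a i).rev) hi (by simp [ha])
  linarith

/-- Binary expansions with infinitely many zeros are unique. -/
theorem ofDigits_injOn : InjOn (Real.ofDigits (b := 2)) {a | ∀ n, ∃ i ≥ n, a i = 0} := by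
  -- If equal values first differ at `n`, with 0 in `a` and 1 in `b`, then the tail of `a` must have
  -- value 1, which a further zero of `a` excludes.
  have key : ∀ a b : ℕ → Fin 2, (∀ n, ∃ i ≥ n, a i = 0) → Real.ofDigits a = Real.ofDigits b →
      ∀ n, trunc a n = trunc b n → a n = 0 → b n ≠ 1 := by
    intro a b ha hab n hn han hbn
    have h1 := ofDigits_eq_trunc a (n + 1)
    have h2 := ofDigits_eq_trunc b (n + 1)
    rw [hab, h2, trunc, trunc, hn, han, hbn] at h1
    obtain ⟨i, hi, hi0⟩ := ha (n + 1)
    have h3 := ofDigits_le_one_sub (a := fun i => a (i + (n + 1))) (i := i - (n + 1))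
      (k := i - (n + 1) + 1) (Nat.lt_succ_self _) (by simpa [Nat.sub_add_cancel hi] using hi0)
    have h4 := Real.ofDigits_nonneg fun i => b (i + (n + 1))
    have h5 : (0 : ℝ) < (2 ^ (i - (n + 1) + 1))⁻¹ := by positivity
    push_cast at h1
    norm_num at h1
    linarith
  intro a ha b hb hab
  have h : ∀ n, trunc a n = trunc b n := fun n => by
    induction n with
    | zero => rfl
    | succ n ih =>
      have h1 := key a b ha hab n ih
      have h2 := key b a hb hab.symm n ih.symm
      have h3 : a n = b n := by
        generalize a n = x at *
        generalize b n = y at *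
        fin_cases x <;> fin_cases y <;> simp_all
      rw [trunc, trunc, ih, h3]
  exact funext fun n => trunc_eq_iff.1 (h (n + 1)) n n.lt_succ_self

/-! ### A planar measure whose first coordinate encodes the second one at sparse scales -/

/-- The space of pairs of binary sequences. -/
abbrev Seqs : Type := ℕ → Fin 2 × Fin 2

/-- Position `i` is coding if it is a power of two. -/
def IsCoding (i : ℕ) : Prop := 2 ^ Nat.log 2 i = i

instance : DecidablePred IsCoding := fun _ => inferInstanceAs (Decidable (_ = _))

/-- The binary digits of the first coordinate: the digits at positions `4 ^ j` and `2 * 4 ^ j` are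
the `j`-th digit of the second coordinate and its complement, the other ones are free. -/
def xDigit (w : Seqs) (i : ℕ) : Fin 2 :=
  if IsCoding i then
    if Even (Nat.log 2 i) then (w (Nat.log 2 i / 2)).2 else (w (Nat.log 2 i / 2)).2.rev
  else (w i).1

/-- The binary digits of the second coordinate, which are free. -/
def yDigit (w : Seqs) (i : ℕ) : Fin 2 := (w i).2

/-- The point of the plane coded by a pair of sequences. -/
noncomputable def codedPoint (w : Seqs) : Fin 2 → ℝ :=
  ![Real.ofDigits (xDigit w), Real.ofDigits (yDigit w)]

/-- A coding digit copies a strictly earlier digit of `y`; hence the first `n` digits of both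
coordinates depend only on the first `n` coin pairs. -/
theorem IsCoding.log_div_two_lt {i : ℕ} (hi : IsCoding i) : Nat.log 2 i / 2 < i := by
  have h0 : i ≠ 0 := by rintro rfl; simp [IsCoding] at hi
  exact (Nat.div_le_self _ _).trans_lt (Nat.log_lt_self 2 h0)

theorem isCoding_two_pow (j : ℕ) : IsCoding (2 ^ j) := by
  rw [IsCoding, Nat.log_pow Nat.one_lt_two]

theorem xDigit_of_not_isCoding (w : Seqs) {i : ℕ} (hi : ¬IsCoding i) : xDigit w i = (w i).1 :=
  if_neg hi

theorem xDigit_four_pow (w : Seqs) (j : ℕ) : xDigit w (2 ^ (2 * j)) = yDigit w j := by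
  rw [xDigit, if_pos (isCoding_two_pow _), Nat.log_pow Nat.one_lt_two,
    if_pos (even_two_mul j), Nat.mul_div_cancel_left _ two_pos, yDigit]

theorem xDigit_two_mul_four_pow (w : Seqs) (j : ℕ) :
    xDigit w (2 ^ (2 * j + 1)) = (yDigit w j).rev := by
  rw [xDigit, if_pos (isCoding_two_pow _), Nat.log_pow Nat.one_lt_two,
    if_neg (by simp), yDigit]
  congr 3
  omega

/-- One of the two complementary copies of the `n`-th digit of `y` is zero, and both sit beyond
position `n`. This is the purpose of the complements. -/
theorem xDigit_exists_zero (w : Seqs) (n : ℕ) : ∃ i ≥ n, xDigit w i = 0 := by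
  by_cases h : yDigit w n = 0
  · exact ⟨2 ^ (2 * n), by have := Nat.lt_two_pow_self (n := 2 * n); omega,
      by rw [xDigit_four_pow, h]⟩
  · refine ⟨2 ^ (2 * n + 1), by have := Nat.lt_two_pow_self (n := 2 * n + 1); omega, ?_⟩
    rw [xDigit_two_mul_four_pow]
    generalize yDigit w n = e at *
    fin_cases e <;> simp_all

theorem injOn_proj₁_range_codedPoint : InjOn proj₁ (range codedPoint) := by
  rintro _ ⟨w, rfl⟩ _ ⟨w', rfl⟩ h
  have hx : xDigit w = xDigit w' :=
    ofDigits_injOn (xDigit_exists_zero w) (xDigit_exists_zero w') h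
  have hy : yDigit w = yDigit w' := funext fun j => by
    rw [← xDigit_four_pow, ← xDigit_four_pow, hx]
  rw [codedPoint, codedPoint, hx, hy]

theorem continuous_codedPoint : Continuous codedPoint := by
  have hx : Continuous xDigit := continuous_pi fun i => by
    unfold xDigit
    split_ifs
    · fun_prop
    · exact (continuous_of_discreteTopology (f := Fin.rev)).comp (by fun_prop)
    · fun_prop
  have hy : Continuous yDigit := continuous_pi fun i => by unfold yDigit; fun_prop
  refine continuous_pi fun i => ?_
  fin_cases i
  · exact Real.continuous_ofDigits.comp hx
  · exact Real.continuous_ofDigits.comp hy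

theorem measurable_codedPoint : Measurable codedPoint := continuous_codedPoint.measurable

/-- The law of a sequence of independent pairs of fair coin tosses. -/
noncomputable def fairCoins : Measure Seqs :=
  Measure.infinitePi fun _ => ProbabilityTheory.uniformOn univ

instance isProbabilityMeasure_uniformOn_univ :
    IsProbabilityMeasure (ProbabilityTheory.uniformOn (univ : Set (Fin 2 × Fin 2))) :=
  ProbabilityTheory.isProbabilityMeasure_uniformOn finite_univ univ_nonempty

instance : IsProbabilityMeasure fairCoins :=
  inferInstanceAs (IsProbabilityMeasure (Measure.infinitePi _))

theorem fairCoins_real_pi (s : Finset ℕ) (t : ℕ → Finset (Fin 2 × Fin 2)) :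
    fairCoins.real (Set.pi s fun i => (t i : Set (Fin 2 × Fin 2))) =
      ∏ i ∈ s, ((t i).card : ℝ) / 4 := by
  rw [measureReal_def, fairCoins, Measure.infinitePi_pi _ fun i _ => (t i).measurableSet,
    ENNReal.toReal_prod]
  refine Finset.prod_congr rfl fun i _ => ?_
  rw [ProbabilityTheory.uniformOn_univ, Measure.count_apply_finset, ENNReal.toReal_div]
  simp

/-- The law of the coded point. -/
noncomputable def codedMeasure : Measure (Fin 2 → ℝ) := fairCoins.map codedPoint

instance : IsProbabilityMeasure codedMeasure :=
  Measure.isProbabilityMeasure_map measurable_codedPoint.aemeasurable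

/-- The mass of a dyadic cell of level `n`. -/
noncomputable def cellMass (n : ℕ) : ℝ := ∏ i ∈ Finset.range n, if IsCoding i then 1 / 2 else 1 / 4

theorem cellMass_pos (n : ℕ) : 0 < cellMass n :=
  Finset.prod_pos fun i _ => by split_ifs <;> norm_num

/-- The event that the coded point lies in a given dyadic cell of level `n`. -/
def cell (n i j : ℕ) : Set Seqs := {w | trunc (xDigit w) n = i ∧ trunc (yDigit w) n = j}

/-- At a coding position the digit of `x` is already forced by earlier ones, so the cell leaves the
first coin there free (2 of 4 outcomes); elsewhere it fixes both coins (1 of 4). All nonempty cells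
of a level thus have equal mass. -/
theorem fairCoins_real_cell (n : ℕ) (w : Seqs) :
    fairCoins.real (cell n (trunc (xDigit w) n) (trunc (yDigit w) n)) = cellMass n := by
  have h : cell n (trunc (xDigit w) n) (trunc (yDigit w) n) = Set.pi (Finset.range n) fun i =>
      ((if IsCoding i then {(0, (w i).2), (1, (w i).2)} else {w i} :
        Finset (Fin 2 × Fin 2)) : Set (Fin 2 × Fin 2)) := by
    ext w'
    simp only [cell, mem_ofPred_eq, trunc_eq_iff, Set.mem_pi, Finset.coe_range, mem_Iio]
    have hbr : ∀ i, w' i ∈ ((if IsCoding i then {(0, (w i).2), (1, (w i).2)} else {w i} :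
        Finset (Fin 2 × Fin 2)) : Set (Fin 2 × Fin 2)) ↔
        (w' i).2 = (w i).2 ∧ (IsCoding i ∨ (w' i).1 = (w i).1) := fun i => by
      have : (w' i).1 = 0 ∨ (w' i).1 = 1 := by
        generalize (w' i).1 = e; fin_cases e <;> simp
      split_ifs with hi
      · simp only [Finset.coe_insert, Finset.coe_singleton, mem_insert_iff, mem_singleton_iff,
          Prod.ext_iff, hi, true_or, and_true]
        tauto
      · simp only [Finset.coe_singleton, mem_singleton_iff, Prod.ext_iff, hi, false_or]
        tauto
    simp only [hbr]
    constructor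
    · rintro ⟨hx, hy⟩ i hi
      refine ⟨hy i hi, ?_⟩
      by_cases hc : IsCoding i
      · exact Or.inl hc
      · exact Or.inr (by simpa [xDigit_of_not_isCoding _ hc] using hx i hi)
    · refine fun h => ⟨fun i hi => ?_, fun i hi => (h i hi).1⟩
      by_cases hc : IsCoding i
      · simp only [xDigit, if_pos hc, (h _ (hc.log_div_two_lt.trans hi)).1]
      · rw [xDigit_of_not_isCoding _ hc, xDigit_of_not_isCoding _ hc]
        exact (h i hi).2.resolve_left hc
  rw [h, fairCoins_real_pi, cellMass]
  refine Finset.prod_congr rfl fun i _ => ?_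
  split_ifs
  · rw [Finset.card_pair (by simp)]; norm_num
  · simp

theorem fairCoins_real_cell_le (n i j : ℕ) : fairCoins.real (cell n i j) ≤ cellMass n := by
  rcases (cell n i j).eq_empty_or_nonempty with h | ⟨w, rfl, rfl⟩
  · rw [h, measureReal_empty]; exact (cellMass_pos n).le
  · exact (fairCoins_real_cell n w).le

/-- Cells are full between coding positions. -/
theorem fairCoins_real_cell_of_free {p k : ℕ} (hfree : ∀ l, p ≤ l → l < p + k → ¬IsCoding l)
    (w : Seqs) {u v : ℕ} (hu : u < 2 ^ k) (hv : v < 2 ^ k) :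
    fairCoins.real (cell (p + k) (trunc (xDigit w) p * 2 ^ k + u)
      (trunc (yDigit w) p * 2 ^ k + v)) = cellMass (p + k) := by
  obtain ⟨a, rfl⟩ := exists_trunc_eq hu
  obtain ⟨b, rfl⟩ := exists_trunc_eq hv
  -- It suffices to show that the cell is nonempty: keep the coins before `p`, and use the required
  -- digits as the free coins afterwards.
  set w' : Seqs := fun l => if l < p then w l else (a (l - p), b (l - p)) with hw'
  have hlow : ∀ l < p, w' l = w l := fun l hl => if_pos hl
  have hx : trunc (xDigit w') (p + k) = trunc (xDigit w) p * 2 ^ k + trunc a k := by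
    rw [trunc_add]
    congr 1
    · congr 1
      refine trunc_eq_iff.2 fun i hi => ?_
      unfold xDigit
      split_ifs with hc he
      · rw [hlow _ (hc.log_div_two_lt.trans hi)]
      · rw [hlow _ (hc.log_div_two_lt.trans hi)]
      · rw [hlow i hi]
    · refine trunc_eq_iff.2 fun i hi => ?_
      rw [xDigit_of_not_isCoding _ (hfree _ (by omega) (by omega)), hw']
      simp
  have hy : trunc (yDigit w') (p + k) = trunc (yDigit w) p * 2 ^ k + trunc b k := by
    rw [trunc_add]
    congr 1
    · congr 1
      refine trunc_eq_iff.2 fun i hi => ?_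
      rw [yDigit, yDigit, hlow i hi]
    · refine trunc_eq_iff.2 fun i hi => ?_
      rw [yDigit, hw']
      simp
  rw [← hx, ← hy, fairCoins_real_cell]

/-! ### The mass of boxes -/

/-- Each coding position among `0, …, n` contributes a factor 2, and `Nat.size n` counts the powers
of two up to `n`. -/
theorem cellMass_succ_mul_pow_le (n : ℕ) : cellMass (n + 1) * 4 ^ (n + 1) ≤ 2 ^ Nat.size n := by
  induction n with
  | zero => simp [cellMass, IsCoding]
  | succ n ih =>
    have hsize : Nat.size n ≤ Nat.size (n + 1) := Nat.size_le_size (Nat.le_succ n)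
    rw [cellMass, Finset.prod_range_succ, ← cellMass, pow_succ]
    split_ifs with hc
    · have h1 : Nat.size n + 1 ≤ Nat.size (n + 1) := by
        rw [← hc, Nat.size_pow, Nat.succ_le_succ_iff, Nat.size_le]
        have : 2 ^ Nat.log 2 (n + 1) = n + 1 := hc
        omega
      have h2 : (2 : ℝ) ^ (Nat.size n + 1) ≤ 2 ^ Nat.size (n + 1) :=
        pow_le_pow_right₀ one_le_two h1
      rw [pow_succ] at h2
      linarith
    · have h2 : (2 : ℝ) ^ Nat.size n ≤ 2 ^ Nat.size (n + 1) := pow_le_pow_right₀ one_le_two hsize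
      linarith

theorem cellMass_mul_pow_le (n : ℕ) : cellMass n * 4 ^ n ≤ 2 * (n + 1) := by
  rcases n with _ | n
  · simp [cellMass]
  · refine (cellMass_succ_mul_pow_le n).trans ?_
    rcases Nat.eq_zero_or_pos (Nat.size n) with h | h
    · rw [h]; push_cast; have := n.cast_nonneg (α := ℝ); linarith
    · have h1 : 2 ^ (Nat.size n - 1) ≤ n := Nat.lt_size.1 (by omega)
      have h2 : (2 : ℝ) ^ Nat.size n = 2 ^ (Nat.size n - 1) * 2 := by
        rw [← pow_succ, Nat.sub_add_cancel h]
      have h3 : (2 : ℝ) ^ (Nat.size n - 1) ≤ n := by exact_mod_cast h1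
      rw [h2]; push_cast; linarith

theorem one_le_cellMass_mul_pow (n : ℕ) : 1 ≤ cellMass n * 4 ^ n := by
  induction n with
  | zero => simp [cellMass]
  | succ n ih =>
    rw [cellMass, Finset.prod_range_succ, ← cellMass, pow_succ]
    split_ifs <;> linarith

theorem measurable_trunc {f : Seqs → ℕ → Fin 2} (hf : Measurable f) (n : ℕ) :
    Measurable fun w => trunc (f w) n := by
  induction n with
  | zero => exact measurable_const
  | succ n ih =>
    have h : Measurable fun w => ((f w n : Fin 2) : ℕ) :=
      (measurable_of_finite _).comp ((measurable_pi_apply n).comp hf)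
    exact (ih.const_mul 2).add h

theorem measurable_xDigit : Measurable xDigit := by
  refine measurable_pi_lambda _ fun i => ?_
  unfold xDigit
  split_ifs
  · fun_prop
  · exact (measurable_of_finite Fin.rev).comp (by fun_prop)
  · fun_prop

theorem measurable_yDigit : Measurable yDigit :=
  measurable_pi_lambda _ fun i => by unfold yDigit; fun_prop

theorem measurableSet_cell (n i j : ℕ) : MeasurableSet (cell n i j) :=
  (measurable_trunc measurable_xDigit n (measurableSet_singleton i)).inter
    (measurable_trunc measurable_yDigit n (measurableSet_singleton j))

theorem codedMeasure_real_apply {s : Set (Fin 2 → ℝ)} (hs : MeasurableSet s) :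
    codedMeasure.real s = fairCoins.real (codedPoint ⁻¹' s) :=
  map_measureReal_apply measurable_codedPoint hs

theorem mem_Icc_codedPoint {w : Seqs} {a b : Fin 2 → ℝ} : codedPoint w ∈ Icc a b ↔
    (a 0 ≤ Real.ofDigits (xDigit w) ∧ Real.ofDigits (xDigit w) ≤ b 0) ∧
      (a 1 ≤ Real.ofDigits (yDigit w) ∧ Real.ofDigits (yDigit w) ≤ b 1) := by
  simp only [codedPoint, mem_Icc, Pi.le_def, Fin.forall_fin_two, Matrix.cons_val_zero,
    Matrix.cons_val_one]
  tauto

theorem card_Icc_ceil_floor_le {y z : ℝ} (h : y ≤ z) :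
    ((Finset.Icc ⌈y - 1⌉₊ ⌊z⌋₊).card : ℝ) ≤ z - y + 2 := by
  rw [Nat.card_Icc]
  rcases le_total (⌊z⌋₊ + 1) ⌈y - 1⌉₊ with h1 | h1
  · rw [Nat.sub_eq_zero_of_le h1]; push_cast; linarith
  · rw [Nat.cast_sub h1]
    push_cast
    have h2 := Nat.le_ceil (y - 1)
    rcases le_total 0 z with hz | hz
    · linarith [Nat.floor_le hz]
    · rw [Nat.floor_of_nonpos hz]
      have : (0 : ℝ) ≤ ⌈y - 1⌉₊ := Nat.cast_nonneg _
      push_cast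
      linarith

theorem le_card_Ico_ceil_floor {y z : ℝ} (h : 0 ≤ y) :
    max 0 (z - y - 2) ≤ ((Finset.Ico ⌈y⌉₊ ⌊z⌋₊).card : ℝ) := by
  refine max_le (Nat.cast_nonneg _) ?_
  rw [Nat.card_Ico]
  have h1 := Nat.ceil_lt_add_one h
  have h2 := Nat.lt_floor_add_one z
  have h3 : (⌊z⌋₊ : ℝ) ≤ ((⌊z⌋₊ - ⌈y⌉₊ : ℕ) : ℝ) + ⌈y⌉₊ := by exact_mod_cast le_tsub_add
  linarith

/-- Cover the box by dyadic cells of level `n` and count them. Since a binary value can equal the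
right end of its cell, the cell to the left must be included, whence the `- 1` in `I` and `J`. -/
theorem codedMeasure_real_Icc_le (n : ℕ) {a b : Fin 2 → ℝ} (hab : a ≤ b) :
    codedMeasure.real (Icc a b) ≤
      cellMass n * (((b 0 - a 0) * 2 ^ n + 2) * ((b 1 - a 1) * 2 ^ n + 2)) := by
  set I := Finset.Icc ⌈a 0 * 2 ^ n - 1⌉₊ ⌊b 0 * 2 ^ n⌋₊
  set J := Finset.Icc ⌈a 1 * 2 ^ n - 1⌉₊ ⌊b 1 * 2 ^ n⌋₊
  have hsub : codedPoint ⁻¹' Icc a b ⊆ ⋃ q ∈ I ×ˢ J, cell n q.1 q.2 := by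
    intro w hw
    rw [mem_preimage, mem_Icc_codedPoint] at hw
    have hpos : (0 : ℝ) < 2 ^ n := by positivity
    have key : ∀ (d : ℕ → Fin 2) (y z : ℝ), y ≤ Real.ofDigits d → Real.ofDigits d ≤ z →
        trunc d n ∈ Finset.Icc ⌈y * 2 ^ n - 1⌉₊ ⌊z * 2 ^ n⌋₊ := fun d y z hy hz => by
      have h1 := trunc_le_ofDigits d n
      have h2 := ofDigits_le_trunc_add_one d n
      refine Finset.mem_Icc.2 ⟨Nat.ceil_le.2 ?_, Nat.le_floor ?_⟩
      · linarith [mul_le_mul_of_nonneg_right hy hpos.le]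
      · linarith [mul_le_mul_of_nonneg_right hz hpos.le]
    simp only [mem_iUnion]
    exact ⟨(trunc (xDigit w) n, trunc (yDigit w) n),
      Finset.mk_mem_product (key _ _ _ hw.1.1 hw.1.2) (key _ _ _ hw.2.1 hw.2.2), rfl, rfl⟩
  have hpow : (0 : ℝ) ≤ 2 ^ n := by positivity
  have hI : (I.card : ℝ) ≤ (b 0 - a 0) * 2 ^ n + 2 := by
    have := card_Icc_ceil_floor_le (mul_le_mul_of_nonneg_right (hab 0) hpow)
    linarith
  have hJ : (J.card : ℝ) ≤ (b 1 - a 1) * 2 ^ n + 2 := by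
    have := card_Icc_ceil_floor_le (mul_le_mul_of_nonneg_right (hab 1) hpow)
    linarith
  have hb : 0 ≤ (b 0 - a 0) * 2 ^ n := mul_nonneg (sub_nonneg.2 (hab 0)) hpow
  calc codedMeasure.real (Icc a b) = fairCoins.real (codedPoint ⁻¹' Icc a b) :=
        codedMeasure_real_apply measurableSet_Icc
    _ ≤ fairCoins.real (⋃ q ∈ I ×ˢ J, cell n q.1 q.2) :=
        measureReal_mono hsub (measure_ne_top _ _)
    _ ≤ ∑ q ∈ I ×ˢ J, fairCoins.real (cell n q.1 q.2) := measureReal_biUnion_finset_le _ _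
    _ ≤ ∑ _q ∈ I ×ˢ J, cellMass n := Finset.sum_le_sum fun q _ => fairCoins_real_cell_le n q.1 q.2
    _ = cellMass n * (I.card * J.card) := by
        rw [Finset.sum_const, Finset.card_product, nsmul_eq_mul]; push_cast; ring
    _ ≤ _ := by
        refine mul_le_mul_of_nonneg_left ?_ (cellMass_pos n).le
        exact mul_le_mul hI hJ (Nat.cast_nonneg _) (by linarith)

/-- The box lies inside one charged cell of level `p`, and no digit between levels `p` and `p + k`
is coding. So every subcell of level `p + k` inside the box is charged, and it remains to count
them. -/
theorem le_codedMeasure_real_Icc {p k : ℕ} (hfree : ∀ l, p ≤ l → l < p + k → ¬IsCoding l)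
    (w : Seqs) {a b : Fin 2 → ℝ} (ha0 : trunc (xDigit w) p ≤ a 0 * 2 ^ p)
    (hb0 : b 0 * 2 ^ p ≤ trunc (xDigit w) p + 1) (ha1 : trunc (yDigit w) p ≤ a 1 * 2 ^ p)
    (hb1 : b 1 * 2 ^ p ≤ trunc (yDigit w) p + 1) :
    cellMass (p + k) * (max 0 ((b 0 - a 0) * 2 ^ (p + k) - 2) *
      max 0 ((b 1 - a 1) * 2 ^ (p + k) - 2)) ≤ codedMeasure.real (Icc a b) := by
  set m := p + k
  set I := Finset.Ico ⌈a 0 * 2 ^ m⌉₊ ⌊b 0 * 2 ^ m⌋₊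
  set J := Finset.Ico ⌈a 1 * 2 ^ m⌉₊ ⌊b 1 * 2 ^ m⌋₊
  have hpos : (0 : ℝ) < 2 ^ m := by positivity
  have hmem : ∀ (y z : ℝ) (i : ℕ), i ∈ Finset.Ico ⌈y * 2 ^ m⌉₊ ⌊z * 2 ^ m⌋₊ →
      y * 2 ^ m ≤ i ∧ (i : ℝ) + 1 ≤ z * 2 ^ m := fun y z i hi => by
    rw [Finset.mem_Ico, Nat.ceil_le] at hi
    refine ⟨hi.1, ?_⟩
    have h1 : i + 1 ≤ ⌊z * 2 ^ m⌋₊ := hi.2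
    have h2 := (Nat.le_floor_iff' (Nat.succ_ne_zero i)).1 h1
    exact_mod_cast h2
  have hsub : (⋃ q ∈ I ×ˢ J, cell m q.1 q.2) ⊆ codedPoint ⁻¹' Icc a b := by
    refine iUnion₂_subset ?_
    rintro ⟨i, j⟩ hij w' ⟨hi, hj⟩
    rw [Finset.mem_product] at hij
    have key : ∀ (d : ℕ → Fin 2) (y z : ℝ), trunc d m ∈ Finset.Ico ⌈y * 2 ^ m⌉₊ ⌊z * 2 ^ m⌋₊ →
        y ≤ Real.ofDigits d ∧ Real.ofDigits d ≤ z := fun d y z h => by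
      have h0 := hmem y z _ h
      have h1 := trunc_le_ofDigits d m
      have h2 := ofDigits_le_trunc_add_one d m
      exact ⟨le_of_mul_le_mul_right (by linarith) hpos,
        le_of_mul_le_mul_right (by linarith) hpos⟩
    exact mem_Icc_codedPoint.2 ⟨key _ _ _ (hi ▸ hij.1), key _ _ _ (hj ▸ hij.2)⟩
  have hsplit : ∀ (X : ℕ) (y z : ℝ), (X : ℝ) ≤ y * 2 ^ p → z * 2 ^ p ≤ X + 1 →
      ∀ i ∈ Finset.Ico ⌈y * 2 ^ m⌉₊ ⌊z * 2 ^ m⌋₊, ∃ u < 2 ^ k, i = X * 2 ^ k + u := by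
    intro X y z hy hz i hi
    have h0 := hmem y z i hi
    have hk : (0 : ℝ) < 2 ^ k := by positivity
    rw [show (2 : ℝ) ^ m = 2 ^ p * 2 ^ k from pow_add _ _ _, ← mul_assoc, ← mul_assoc] at h0
    have h1 : (X : ℝ) * 2 ^ k ≤ i := (mul_le_mul_of_nonneg_right hy hk.le).trans h0.1
    have h2 : (i : ℝ) + 1 ≤ (X + 1) * 2 ^ k := h0.2.trans (mul_le_mul_of_nonneg_right hz hk.le)
    have h3 : X * 2 ^ k ≤ i := by exact_mod_cast h1
    have h4 : i + 1 ≤ (X + 1) * 2 ^ k := by exact_mod_cast h2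
    refine ⟨i - X * 2 ^ k, ?_, by omega⟩
    rw [add_mul, one_mul] at h4
    omega
  have hcell : ∀ q ∈ I ×ˢ J, fairCoins.real (cell m q.1 q.2) = cellMass m := by
    rintro ⟨i, j⟩ hij
    rw [Finset.mem_product] at hij
    obtain ⟨u, hu, hi⟩ := hsplit _ _ _ ha0 hb0 i hij.1
    obtain ⟨v, hv, hj⟩ := hsplit _ _ _ ha1 hb1 j hij.2
    simp only [hi, hj]
    exact fairCoins_real_cell_of_free hfree w hu hv
  have hI : max 0 ((b 0 - a 0) * 2 ^ m - 2) ≤ (I.card : ℝ) := by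
    have ha : 0 ≤ a 0 := by
      have := (Nat.cast_nonneg (α := ℝ) (trunc (xDigit w) p)).trans ha0
      exact nonneg_of_mul_nonneg_left this (by positivity)
    rw [sub_mul]
    exact le_card_Ico_ceil_floor (by positivity)
  have hJ : max 0 ((b 1 - a 1) * 2 ^ m - 2) ≤ (J.card : ℝ) := by
    have ha : 0 ≤ a 1 := by
      have := (Nat.cast_nonneg (α := ℝ) (trunc (yDigit w) p)).trans ha1
      exact nonneg_of_mul_nonneg_left this (by positivity)
    rw [sub_mul]
    exact le_card_Ico_ceil_floor (by positivity)
  calc _ ≤ cellMass m * (I.card * J.card) :=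
        mul_le_mul_of_nonneg_left (mul_le_mul hI hJ (le_max_left _ _) (Nat.cast_nonneg _))
          (cellMass_pos m).le
    _ = ∑ _q ∈ I ×ˢ J, cellMass m := by
        rw [Finset.sum_const, Finset.card_product, nsmul_eq_mul]; push_cast; ring
    _ = ∑ q ∈ I ×ˢ J, fairCoins.real (cell m q.1 q.2) :=
        Finset.sum_congr rfl fun q hq => (hcell q hq).symm
    _ = fairCoins.real (⋃ q ∈ I ×ˢ J, cell m q.1 q.2) :=
        (measureReal_biUnion_finset (fun q _ q' _ hne => disjoint_left.2 fun w' h h' =>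
          hne (Prod.ext (h.1.symm.trans h'.1) (h.2.symm.trans h'.2)))
          fun q _ => measurableSet_cell _ _ _).symm
    _ ≤ fairCoins.real (codedPoint ⁻¹' Icc a b) :=
        measureReal_mono hsub (measure_ne_top _ _)
    _ = _ := (codedMeasure_real_apply measurableSet_Icc).symm

theorem closedBall_eq_Icc_fin_two (z : Fin 2 → ℝ) {r : ℝ} (hr : 0 ≤ r) :
    Metric.closedBall z r = Icc (fun i => z i - r) fun i => z i + r := by
  rw [closedBall_pi _ hr, ← pi_univ_Icc]
  simp only [Real.closedBall_eq_Icc]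

/-- Lines parallel to the axes are null sets. -/
theorem codedMeasure_line (i : Fin 2) (y : ℝ) : codedMeasure {z | z i = y} = 0 := by
  have hms : MeasurableSet {z : Fin 2 → ℝ | z i = y} :=
    measurableSet_eq_fun (measurable_pi_apply i) measurable_const
  set a : Fin 2 → ℝ := Function.update 0 i y
  set b : Fin 2 → ℝ := Function.update 1 i y
  have hab : a ≤ b := by
    intro j
    by_cases h : j = i <;> simp [a, b, h]
  have hle : codedMeasure.real {z | z i = y} ≤ codedMeasure.real (Icc a b) := by
    rw [codedMeasure_real_apply hms, codedMeasure_real_apply measurableSet_Icc]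
    refine measureReal_mono fun w hw => ?_
    have hw : codedPoint w i = y := hw
    have h01 : ∀ j, 0 ≤ codedPoint w j ∧ codedPoint w j ≤ 1 := by
      simp only [codedPoint, Fin.forall_fin_two, Matrix.cons_val_zero, Matrix.cons_val_one]
      exact ⟨⟨Real.ofDigits_nonneg _, Real.ofDigits_le_one _⟩,
        Real.ofDigits_nonneg _, Real.ofDigits_le_one _⟩
    refine ⟨fun j => ?_, fun j => ?_⟩ <;> by_cases h : j = i
    · subst h; simp [a, hw]
    · simpa [a, Function.update_of_ne h] using (h01 j).1
    · subst h; simp [b, hw]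
    · simpa [b, Function.update_of_ne h] using (h01 j).2
  -- A segment of unit length is covered by at most `2 * (2 ^ n + 2) ≤ 6 * 2 ^ n` cells, each of
  -- mass at most `2 * (n + 1) / 4 ^ n`.
  have hbound : ∀ n : ℕ, codedMeasure.real {z | z i = y} ≤ 12 * ((n + 1) * (1 / 2) ^ n) := by
    intro n
    have h1 := codedMeasure_real_Icc_le n hab
    have h2 : ((b 0 - a 0) * 2 ^ n + 2) * ((b 1 - a 1) * 2 ^ n + 2) = 2 * ((2 : ℝ) ^ n + 2) := by
      fin_cases i
      · simp [a, b]
      · simp [a, b]; ring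
    have h3 := cellMass_mul_pow_le n
    have h4 : (1 : ℝ) ≤ 2 ^ n := one_le_pow₀ one_le_two
    have h5 : (4 : ℝ) ^ n = 2 ^ n * 2 ^ n := by rw [← mul_pow]; norm_num
    have h6 := cellMass_pos n
    rw [h2] at h1
    rw [h5] at h3
    rw [one_div, inv_pow, ← div_eq_mul_inv, mul_div_assoc', le_div_iff₀ (by positivity)]
    have h7 : codedMeasure.real {z | z i = y} * 2 ^ n ≤ cellMass n * (6 * 2 ^ n) * 2 ^ n := by
      refine mul_le_mul_of_nonneg_right ((hle.trans h1).trans ?_) (by positivity)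
      exact mul_le_mul_of_nonneg_left (by linarith) h6.le
    linarith
  have hlim : Tendsto (fun n : ℕ => 12 * (((n : ℝ) + 1) * (1 / 2) ^ n)) atTop (𝓝 0) := by
    have h1 := tendsto_self_mul_const_pow_of_lt_one (r := 1 / 2) (by norm_num) (by norm_num)
    have h2 := tendsto_pow_atTop_nhds_zero_of_lt_one (r := (1 / 2 : ℝ)) (by norm_num) (by norm_num)
    have h3 := (h1.add h2).const_mul 12
    simp only [add_zero, mul_zero] at h3
    refine h3.congr fun n => by ring
  have h0 := le_antisymm (ge_of_tendsto' hlim hbound) measureReal_nonneg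
  exact (measureReal_eq_zero_iff (by finiteness)).1 h0

/-! ### Dimension of the measure, of its projection and of its fibres -/

theorem tendsto_const_div_log_zero (c : ℝ) :
    Tendsto (fun r => c / Real.log r) (𝓝[>] 0) (𝓝 0) :=
  tendsto_const_nhds.div_atBot Real.tendsto_log_nhdsGT_zero

theorem tendsto_log_one_sub_two_mul_div_atBot :
    Tendsto (fun L : ℝ => Real.log (1 - 2 * L) / L) atBot (𝓝 0) := by
  have h1 : Tendsto (fun L : ℝ => 1 - 2 * L) atBot atTop :=
    tendsto_atTop_add_const_left _ 1 (tendsto_neg_atBot_atTop.comp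
      (tendsto_id.const_mul_atBot two_pos)) |>.congr fun L => by simp [sub_eq_add_neg]
  have h2 : Tendsto (fun u : ℝ => Real.log u / u) atTop (𝓝 0) :=
    Real.isLittleO_log_id_atTop.tendsto_div_nhds_zero
  have h3 : Tendsto (fun L : ℝ => 1 / L - 2) atBot (𝓝 (0 - 2)) :=
    (tendsto_const_nhds.div_atBot tendsto_id).sub tendsto_const_nhds
  have h4 := (h2.comp h1).mul h3
  rw [zero_mul] at h4
  refine h4.congr' ?_
  filter_upwards [eventually_lt_atBot 0] with L hL
  have : 1 - 2 * L ≠ 0 := by linarith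
  have := hL.ne
  simp only [Function.comp_apply]
  field_simp

/-- Mass comparable to `r ^ 2` up to a logarithmic factor gives local dimension two. -/
theorem tendsto_log_div_log_two {v : ℝ → ℝ} {c C : ℝ} (hc : 0 < c) (hC : 0 < C)
    (hv : ∀ r, 0 < r → r < 1 → c * r ^ 2 ≤ v r ∧ v r ≤ C * r ^ 2 * (1 - 2 * Real.log r)) :
    Tendsto (fun r => Real.log (v r) / Real.log r) (𝓝[>] 0) (𝓝 2) := by
  have hlow : Tendsto (fun r => Real.log C / Real.log r + 2 +
      Real.log (1 - 2 * Real.log r) / Real.log r) (𝓝[>] 0) (𝓝 (0 + 2 + 0)) :=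
    ((tendsto_const_div_log_zero _).add_const 2).add
      (tendsto_log_one_sub_two_mul_div_atBot.comp Real.tendsto_log_nhdsGT_zero)
  have hup : Tendsto (fun r => Real.log c / Real.log r + 2) (𝓝[>] 0) (𝓝 (0 + 2)) :=
    (tendsto_const_div_log_zero _).add_const 2
  rw [zero_add, add_zero] at hlow
  rw [zero_add] at hup
  refine tendsto_of_tendsto_of_tendsto_of_le_of_le' hlow hup ?_ ?_
  all_goals
    filter_upwards [Ioo_mem_nhdsGT (zero_lt_one' ℝ)] with r hr
    have hL := Real.log_neg hr.1 hr.2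
    obtain ⟨h1, h2⟩ := hv r hr.1 hr.2
    have hr2 : 0 < r ^ 2 := pow_pos hr.1 2
    have hv0 : 0 < v r := (mul_pos hc hr2).trans_le h1
  · have h3 := Real.log_le_log hv0 h2
    rw [Real.log_mul (by positivity) (by linarith), Real.log_mul hC.ne' hr2.ne', Real.log_pow] at h3
    rw [le_div_iff_of_neg hL, add_mul, add_mul, div_mul_cancel₀ _ hL.ne, div_mul_cancel₀ _ hL.ne]
    push_cast at h3
    linarith
  · have h3 := Real.log_le_log (by positivity) h1
    rw [Real.log_mul hc.ne' hr2.ne', Real.log_pow] at h3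
    rw [div_le_iff_of_neg hL, add_mul, div_mul_cancel₀ _ hL.ne]
    push_cast at h3
    linarith

/-- Mass at least comparable to `r` gives upper local dimension at most one. -/
theorem limsup_log_div_log_le_one {v : ℝ → ℝ} {c : ℝ} (hc : 0 < c)
    (hv : ∀ r, 0 < r → r < 1 → c * r ≤ v r) :
    limsup (fun r => ((Real.log (v r) / Real.log r : ℝ) : EReal)) (𝓝[>] 0) ≤ 1 := by
  have hup : Tendsto (fun r => Real.log c / Real.log r + 1) (𝓝[>] 0) (𝓝 (0 + 1)) :=
    (tendsto_const_div_log_zero _).add_const 1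
  rw [zero_add] at hup
  have hup' := (continuous_coe_real_ereal.tendsto 1).comp hup
  refine (limsup_le_limsup ?_).trans_eq hup'.limsup_eq
  filter_upwards [Ioo_mem_nhdsGT (zero_lt_one' ℝ)] with r hr
  have hL := Real.log_neg hr.1 hr.2
  have h3 := Real.log_le_log (mul_pos hc hr.1) (hv r hr.1 hr.2)
  rw [Real.log_mul hc.ne' hr.1.ne'] at h3
  simp only [Function.comp_apply, EReal.coe_le_coe_iff]
  rw [div_le_iff_of_neg hL, add_mul, div_mul_cancel₀ _ hL.ne]
  linarith

/-- The dyadic scale of a radius. -/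
theorem exists_dyadic_scale {r : ℝ} (hr : 0 < r) (hr1 : r < 1) :
    ∃ n : ℕ, 1 < r * 2 ^ (n + 1) ∧ r * 2 ^ n ≤ 1 ∧ (n : ℝ) ≤ -2 * Real.log r := by
  obtain ⟨n, h1, h2⟩ := exists_nat_pow_near_of_lt_one hr hr1.le
    (show (0 : ℝ) < 1 / 2 by norm_num) (by norm_num)
  rw [one_div, inv_pow, inv_lt_iff_one_lt_mul₀ (by positivity)] at h1
  rw [one_div, inv_pow, le_inv_comm₀ hr (by positivity)] at h2
  have h3 : r * 2 ^ n ≤ 1 :=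
    (mul_le_mul_of_nonneg_left h2 hr.le).trans_eq (mul_inv_cancel₀ hr.ne')
  refine ⟨n, by linarith, h3, ?_⟩
  have h4 := Real.log_nonpos (by positivity) h3
  rw [Real.log_mul hr.ne' (by positivity), Real.log_pow] at h4
  have h5 := Real.log_two_gt_d9
  nlinarith [(Nat.cast_nonneg n : (0 : ℝ) ≤ n)]

theorem dist_codedPoint_le {w w' : Seqs} {n : ℕ} (h : w' ∈ cell n (trunc (xDigit w) n)
    (trunc (yDigit w) n)) : dist (codedPoint w') (codedPoint w) ≤ ((2 : ℝ) ^ n)⁻¹ := by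
  refine (dist_pi_le_iff (by positivity)).2 ?_
  rw [Fin.forall_fin_two]
  exact ⟨Real.abs_ofDigits_sub_ofDigits_le (trunc_eq_iff.1 h.1),
    Real.abs_ofDigits_sub_ofDigits_le (trunc_eq_iff.1 h.2)⟩

theorem cellMass_le_codedMeasure_closedBall (w : Seqs) {n : ℕ} {r : ℝ}
    (hr : ((2 : ℝ) ^ n)⁻¹ ≤ r) :
    cellMass n ≤ codedMeasure.real (Metric.closedBall (codedPoint w) r) := by
  rw [codedMeasure_real_apply Metric.isClosed_closedBall.measurableSet, ← fairCoins_real_cell n w]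
  exact measureReal_mono fun w' hw' => (dist_codedPoint_le hw').trans hr

/-- With `2 ^ (-n)` comparable to `r`, the ball contains a cell of level `n + 1` and is covered by
16 cells of level `n`. Their mass is at most `2 * (n + 1) / 4 ^ n`, where `4 ^ (-n) ≤ 4 * r ^ 2` and
`n + 1 ≤ 1 - 2 * log r`; this gives 128 = 16 · 2 · 4. -/
theorem codedMeasure_closedBall_bounds (w : Seqs) {r : ℝ} (hr : 0 < r) (hr1 : r < 1) :
    1 / 4 * r ^ 2 ≤ codedMeasure.real (Metric.closedBall (codedPoint w) r) ∧
      codedMeasure.real (Metric.closedBall (codedPoint w) r) ≤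
        128 * r ^ 2 * (1 - 2 * Real.log r) := by
  obtain ⟨n, h1, h2, h3⟩ := exists_dyadic_scale hr hr1
  have hrn : 0 < r * 2 ^ n := by positivity
  have hsq : ((2 : ℝ) ^ n) ^ 2 = 4 ^ n := by rw [← pow_mul, mul_comm, pow_mul]; norm_num
  have h4n : (0 : ℝ) < 4 ^ n := by positivity
  constructor
  · refine le_trans ?_ (cellMass_le_codedMeasure_closedBall w (n := n + 1) ?_)
    · have h4 := one_le_cellMass_mul_pow (n + 1)
      have h5 : r ^ 2 * 4 ^ n ≤ 1 := by rw [← hsq, ← mul_pow]; exact pow_le_one₀ hrn.le h2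
      rw [pow_succ] at h4
      have h6 : 1 / 4 * r ^ 2 * 4 ^ n ≤ cellMass (n + 1) * 4 ^ n := by linarith
      exact le_of_mul_le_mul_right h6 h4n
    · rw [inv_le_iff_one_le_mul₀ (by positivity)]
      linarith
  · rw [closedBall_eq_Icc_fin_two _ hr.le]
    have h4 := codedMeasure_real_Icc_le n (a := fun i => codedPoint w i - r)
      (b := fun i => codedPoint w i + r) fun i => by linarith
    refine h4.trans ?_
    have h5 : ∀ y : ℝ, (y + r - (y - r)) * 2 ^ n + 2 = 2 * (r * 2 ^ n) + 2 := fun y => by ring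
    simp only [h5]
    have h6 := cellMass_pos n
    have h7 := cellMass_mul_pow_le n
    have h8 : 1 ≤ r ^ 2 * 4 ^ n * 4 := by
      have : (1 : ℝ) ≤ (r * 2 ^ (n + 1)) ^ 2 := one_le_pow₀ h1.le
      rw [show r * 2 ^ (n + 1) = 2 * (r * 2 ^ n) by rw [pow_succ]; ring, mul_pow, mul_pow r,
        hsq] at this
      linarith
    have h9 : (2 * (r * 2 ^ n) + 2) * (2 * (r * 2 ^ n) + 2) ≤ 16 := by nlinarith
    have h10 : cellMass n * 4 ^ n ≤ 8 * r ^ 2 * (1 - 2 * Real.log r) * 4 ^ n := by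
      have h11 : 1 ≤ 1 - 2 * Real.log r := by linarith [(Nat.cast_nonneg n : (0 : ℝ) ≤ n)]
      nlinarith
    have h12 := le_of_mul_le_mul_right h10 h4n
    nlinarith

theorem isCompact_range_codedPoint : IsCompact (range codedPoint) :=
  isCompact_range continuous_codedPoint

theorem codedMeasure_compl_range : codedMeasure (range codedPoint)ᶜ = 0 := by
  rw [codedMeasure, Measure.map_apply measurable_codedPoint
    isCompact_range_codedPoint.isClosed.measurableSet.compl, preimage_compl,
    preimage_range, compl_univ, measure_empty]

theorem ae_mem_range_codedPoint : ∀ᵐ z ∂codedMeasure, z ∈ range codedPoint :=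
  codedMeasure_compl_range

theorem hasExactDim_codedMeasure : HasExactDim codedMeasure 2 := by
  filter_upwards [ae_mem_range_codedPoint]
  rintro _ ⟨w, rfl⟩
  exact tendsto_log_div_log_two (by norm_num) (by norm_num)
    fun r => codedMeasure_closedBall_bounds w

theorem support_codedMeasure_subset : codedMeasure.support ⊆ range codedPoint :=
  Measure.support_subset_of_isClosed isCompact_range_codedPoint.isClosed ae_mem_range_codedPoint

theorem codedPoint_mem_support (w : Seqs) : codedPoint w ∈ codedMeasure.support := by
  rw [(Metric.nhds_basis_closedBall).mem_measureSupport]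
  intro r hr
  obtain ⟨n, hn⟩ := exists_pow_lt_of_lt_one hr (show (1 / 2 : ℝ) < 1 by norm_num)
  have h := cellMass_le_codedMeasure_closedBall w (n := n) (r := r) (by
    rw [one_div, inv_pow] at hn; exact hn.le)
  exact (ENNReal.toReal_pos_iff.1 ((cellMass_pos n).trans_le h)).1

theorem measurable_proj₁ : Measurable proj₁ := measurable_pi_apply 0

/-- The first `n` digits of the first coordinate carry at most `n` bits of information. -/
theorem inv_two_pow_le_fairCoins_xDigit (w : Seqs) (n : ℕ) :
    ((2 : ℝ) ^ n)⁻¹ ≤ fairCoins.real {w' | ∀ i < n, xDigit w' i = xDigit w i} := by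
  -- Fix the free digits of `x`, and those digits of `y` whose first copy, at position `4 ^ i`,
  -- occurs before `n`. This determines the first `n` digits of `x`, and each condition costs one
  -- factor 1/2.
  set t : ℕ → Finset (Fin 2 × Fin 2) := fun i =>
    (if IsCoding i then Finset.univ else {(w i).1}) ×ˢ
      (if 2 ^ (2 * i) < n then {(w i).2} else Finset.univ) with ht
  have hsub : Set.pi (Finset.range n) (fun i => (t i : Set (Fin 2 × Fin 2))) ⊆
      {w' | ∀ i < n, xDigit w' i = xDigit w i} := by
    intro w' hw' i hi
    have hmem : ∀ i < n, w' i ∈ t i := fun i hi => hw' i (by simpa using hi)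
    by_cases hc : IsCoding i
    · have hlt : 2 ^ (2 * (Nat.log 2 i / 2)) < n := by
        refine lt_of_le_of_lt ?_ hi
        conv_rhs => rw [← hc]
        exact Nat.pow_le_pow_right two_pos (Nat.mul_div_le _ _)
      have h := hmem _ (hc.log_div_two_lt.trans hi)
      rw [ht, Finset.mem_product, if_pos hlt, Finset.mem_singleton] at h
      simp only [xDigit, if_pos hc, h.2]
    · have h := hmem i hi
      rw [ht, Finset.mem_product, if_neg hc, Finset.mem_singleton] at h
      rw [xDigit_of_not_isCoding _ hc, xDigit_of_not_isCoding _ hc, h.1]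
  refine le_trans ?_ (measureReal_mono hsub)
  rw [fairCoins_real_pi]
  have hcard : ∀ i, ((t i).card : ℝ) / 4 =
      (if IsCoding i then 1 else 1 / 2) * (if 2 ^ (2 * i) < n then 1 / 2 else 1) := fun i => by
    rw [ht, Finset.card_product]
    split_ifs <;> simp <;> norm_num
  simp only [hcard]
  rw [Finset.prod_mul_distrib, Finset.prod_ite, Finset.prod_ite]
  simp only [Finset.prod_const, one_pow, one_mul, mul_one]
  rw [← pow_add, ← inv_pow, ← one_div]
  refine pow_le_pow_of_le_one (by norm_num) (by norm_num) ?_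
  -- Each fixed digit of `y` is charged to the coding position `4 ^ i` that copies it, so there are
  -- at most `n` conditions in all.
  have h1 : ({i ∈ Finset.range n | 2 ^ (2 * i) < n}).card ≤
      ({i ∈ Finset.range n | IsCoding i}).card := by
    refine Finset.card_le_card_of_injOn (fun i => 2 ^ (2 * i)) (fun i hi => ?_) fun i _ j _ h => ?_
    · simp only [Finset.coe_filter, Finset.mem_range, mem_ofPred_eq] at hi ⊢
      exact ⟨hi.2, isCoding_two_pow _⟩
    · have := Nat.pow_right_injective le_rfl h
      omega
  have h2 : ({i ∈ Finset.range n | IsCoding i}).card +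
      ({i ∈ Finset.range n | ¬IsCoding i}).card = n := by
    rw [Finset.card_filter_add_card_filter_not, Finset.card_range]
  omega

theorem upperDim_map_proj₁_codedMeasure_le : upperDim (codedMeasure.map proj₁) ≤ 1 := by
  have hcomp : IsCompact (proj₁ '' range codedPoint) :=
    isCompact_range_codedPoint.image (continuous_apply 0)
  have hae : ∀ᵐ x ∂codedMeasure.map proj₁, x ∈ proj₁ '' range codedPoint := by
    refine (mem_ae_map_iff measurable_proj₁.aemeasurable hcomp.isClosed.measurableSet).2 ?_
    exact ae_mem_range_codedPoint.mono fun z hz => mem_image_of_mem _ hz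
  refine essSup_le_of_ae_le _ (hae.mono ?_)
  rintro _ ⟨_, ⟨w, rfl⟩, rfl⟩
  refine limsup_log_div_log_le_one (c := 1 / 2) (by norm_num) fun r hr hr1 => ?_
  obtain ⟨n, h1, h2, -⟩ := exists_dyadic_scale hr hr1
  have hms : MeasurableSet (Metric.closedBall (proj₁ (codedPoint w)) r) :=
    Metric.isClosed_closedBall.measurableSet
  rw [map_measureReal_apply measurable_proj₁ hms, codedMeasure_real_apply (measurable_proj₁ hms)]
  have h3 : 1 / 2 * r ≤ ((2 : ℝ) ^ (n + 1))⁻¹ := by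
    rw [← one_div, le_div_iff₀ (by positivity), pow_succ]; linarith
  have h4 : ((2 : ℝ) ^ (n + 1))⁻¹ ≤ r := by
    rw [inv_le_iff_one_le_mul₀ (by positivity)]; linarith
  refine (h3.trans (inv_two_pow_le_fairCoins_xDigit w (n + 1))).trans
    (measureReal_mono fun w' hw' => ?_)
  have h5 := Real.abs_ofDigits_sub_ofDigits_le (b := 2) hw'
  exact (Real.dist_eq _ _).trans_le (h5.trans (by push_cast; exact h4))

instance isProbabilityMeasure_fibreMeas (μ : Measure (Fin 2 → ℝ)) [IsFiniteMeasure μ]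
    (x : Fin 2 → ℝ) : IsProbabilityMeasure (fibreMeas μ x) := by
  unfold fibreMeas; infer_instance

/-- If `proj₁` is injective on a compact set of full measure, then almost every fibre measure is
a point mass. -/
theorem ae_fibreMeas_compl_singleton (μ : Measure (Fin 2 → ℝ)) [IsFiniteMeasure μ]
    {K : Set (Fin 2 → ℝ)} (hK : IsCompact K) (hμ : μ Kᶜ = 0) (hinj : InjOn proj₁ K) :
    ∀ᵐ x ∂μ, fibreMeas μ x {x}ᶜ = 0 := by
  have hm : MeasurableSpace.comap proj₁ inferInstance ≤
      (inferInstance : MeasurableSpace (Fin 2 → ℝ)) := measurable_proj₁.comap_le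
  -- On `K` the set `s` coincides with the saturated set `s'`, which is measurable for the fibre
  -- σ-algebra because injective continuous images of Borel sets are Borel. Hence the conditional
  -- probability of `s` is almost surely the indicator of `s'`.
  have key : ∀ s, MeasurableSet s → ∀ᵐ x ∂μ, x ∉ s → fibreMeas μ x s = 0 := by
    intro s hs
    have hB : MeasurableSet (proj₁ '' (s ∩ K)) :=
      (hs.inter hK.isClosed.measurableSet).image_of_continuousOn_injOn
        (continuous_apply 0).continuousOn (hinj.mono inter_subset_right)
    set s' := proj₁ ⁻¹' (proj₁ '' (s ∩ K)) with hs'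
    have hs'm : MeasurableSet[MeasurableSpace.comap proj₁ inferInstance] s' := ⟨_, hB, rfl⟩
    have hmemK : ∀ᵐ x ∂μ, x ∈ K := hμ
    have hiff : ∀ x ∈ K, x ∈ s' ↔ x ∈ s := fun x hx => by
      refine ⟨?_, fun h => ⟨x, ⟨h, hx⟩, rfl⟩⟩
      rintro ⟨y, hy, hxy⟩
      exact hinj hy.2 hx hxy ▸ hy.1
    have hind : s.indicator (fun _ => (1 : ℝ)) =ᵐ[μ] s'.indicator fun _ => (1 : ℝ) := by
      filter_upwards [hmemK] with x hx
      by_cases h : x ∈ s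
      · rw [indicator_of_mem h, indicator_of_mem ((hiff x hx).2 h)]
      · rw [indicator_of_notMem h, indicator_of_notMem fun h' => h ((hiff x hx).1 h')]
    have h1 := ProbabilityTheory.condExpKernel_ae_eq_condExp (μ := μ) hm hs
    have h2 := condExp_congr_ae (m := MeasurableSpace.comap proj₁ inferInstance) hind
    have h3 : μ[s'.indicator fun _ => (1 : ℝ) | MeasurableSpace.comap proj₁ inferInstance] =
        s'.indicator fun _ => (1 : ℝ) :=
      condExp_of_stronglyMeasurable hm (stronglyMeasurable_const.indicator hs'm)
        ((integrable_const _).indicator (hm _ hs'm))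
    filter_upwards [h1, h2, hmemK] with x hx1 hx2 hxK hxs
    rw [h3, indicator_of_notMem fun h => hxs ((hiff x hxK).1 h)] at hx2
    have h4 := hx1.trans hx2
    exact (measureReal_eq_zero_iff (measure_ne_top _ _)).1 h4
  set b := TopologicalSpace.countableBasis (Fin 2 → ℝ)
  have hb := TopologicalSpace.isBasis_countableBasis (Fin 2 → ℝ)
  have hall : ∀ᵐ x ∂μ, ∀ s ∈ b, x ∉ s → fibreMeas μ x s = 0 :=
    (ae_ball_iff (TopologicalSpace.countable_countableBasis _)).2 fun s hs =>
      key s (hb.isOpen hs).measurableSet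
  filter_upwards [hall] with x hx
  -- Countably many basic open sets avoiding `x` cover its complement, so one null set of
  -- exceptional `x` suffices.
  have hcover : ({x}ᶜ : Set (Fin 2 → ℝ)) ⊆ ⋃ s ∈ {s ∈ b | x ∉ s}, s := fun y hy => by
    obtain ⟨s, hs, hys, hsub⟩ := hb.exists_subset_of_mem_open (show y ∈ ({x}ᶜ : Set _) from hy)
      isOpen_compl_singleton
    exact mem_biUnion (⟨hs, fun h => hsub h rfl⟩ : s ∈ {s ∈ b | x ∉ s}) hys
  refine measure_mono_null hcover ((measure_biUnion_null_iff
    ((TopologicalSpace.countable_countableBasis _).mono fun s hs => hs.1)).2 fun s hs =>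
      hx s hs.1 hs.2)

theorem upperDim_le_zero_of_compl_singleton {E : Type*} [MetricSpace E] [MeasurableSpace E]
    {μ : Measure E} [IsProbabilityMeasure μ] {x : E} (h : μ {x}ᶜ = 0) : upperDim μ ≤ 0 := by
  have hae : ∀ᵐ y ∂μ, y = x := h
  refine essSup_le_of_ae_le _ (hae.mono fun y hy => ?_)
  rw [hy]
  refine limsup_le_of_le (by isBoundedDefault) ?_
  filter_upwards [self_mem_nhdsWithin] with r hr
  have h1 : μ.real (Metric.closedBall x r) = 1 := by
    have : μ (Metric.closedBall x r)ᶜ = 0 := measure_mono_null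
      (compl_subset_compl.2 (singleton_subset_iff.2 (Metric.mem_closedBall_self (le_of_lt hr)))) h
    rw [measureReal_congr (ae_eq_univ.2 this), probReal_univ]
  simp [localDimQuot, h1]

theorem ae_upperDim_add_lt : ∀ᵐ x ∂codedMeasure,
    upperDim (codedMeasure.map proj₁) + upperDim (fibreMeas codedMeasure x) <
      ((2 : ℝ) : EReal) := by
  filter_upwards [ae_fibreMeas_compl_singleton codedMeasure isCompact_range_codedPoint
    codedMeasure_compl_range injOn_proj₁_range_codedPoint] with x hx
  have h := add_le_add upperDim_map_proj₁_codedMeasure_le (upperDim_le_zero_of_compl_singleton hx)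
  rw [add_zero] at h
  refine h.trans_lt ?_
  exact_mod_cast one_lt_two (α := ℝ)

/-! ### Sceneries and weak convergence -/

theorem boxNorm_real_apply {d : ℕ} {μ : Measure (Fin d → ℝ)}
    (h0 : μ (Metric.closedBall 0 1) ≠ 0) (hfin : μ (Metric.closedBall 0 1) ≠ ⊤)
    {s : Set (Fin d → ℝ)} (hs : s ⊆ Metric.closedBall 0 1) :
    (boxNorm μ : Measure (Metric.closedBall (0 : Fin d → ℝ) 1)).real (Subtype.val ⁻¹' s) =
      μ.real s / μ.real (Metric.closedBall 0 1) := by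
  have hms : MeasurableSet (Metric.closedBall (0 : Fin d → ℝ) 1) :=
    Metric.isClosed_closedBall.measurableSet
  have happ : ∀ t ⊆ Metric.closedBall (0 : Fin d → ℝ) 1,
      ((μ (Metric.closedBall 0 1))⁻¹ •
        μ.comap ((↑) : Metric.closedBall (0 : Fin d → ℝ) 1 → Fin d → ℝ)) (Subtype.val ⁻¹' t) =
      (μ (Metric.closedBall 0 1))⁻¹ * μ t := fun t ht => by
    rw [Measure.smul_apply, smul_eq_mul, comap_subtype_coe_apply hms, Subtype.image_preimage_coe,
      inter_eq_right.2 ht]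
  have hprob : IsProbabilityMeasure ((μ (Metric.closedBall 0 1))⁻¹ •
      μ.comap ((↑) : Metric.closedBall (0 : Fin d → ℝ) 1 → Fin d → ℝ)) := by
    constructor
    rw [← Subtype.coe_preimage_self, happ _ subset_rfl, ENNReal.inv_mul_cancel h0 hfin]
  have hcoe : (boxNorm μ : Measure (Metric.closedBall (0 : Fin d → ℝ) 1)) =
      (μ (Metric.closedBall 0 1))⁻¹ • μ.comap ((↑) : Metric.closedBall (0 : Fin d → ℝ) 1 → _) :=
    if_pos hprob
  rw [measureReal_def, hcoe, happ s hs, ENNReal.toReal_mul, ENNReal.toReal_inv, div_eq_inv_mul]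
  rfl

/-- The image of the box `Icc a b` under `y ↦ z + e^{-t} y`. -/
def scaledBox (z a b : Fin 2 → ℝ) (t : ℝ) : Set (Fin 2 → ℝ) :=
  Icc (fun i => z i + Real.exp (-t) * a i) fun i => z i + Real.exp (-t) * b i

theorem measurableSet_scaledBox (z a b : Fin 2 → ℝ) (t : ℝ) : MeasurableSet (scaledBox z a b t) :=
  measurableSet_Icc

theorem scaledBox_neg_one_one (z : Fin 2 → ℝ) (t : ℝ) :
    scaledBox z (-1) 1 t = Metric.closedBall z (Real.exp (-t)) := by
  rw [closedBall_eq_Icc_fin_two _ (Real.exp_pos _).le, scaledBox]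
  simp [sub_eq_add_neg]

theorem closedBall_zero_one_eq_Icc : Metric.closedBall (0 : Fin 2 → ℝ) 1 = Icc (-1) 1 := by
  rw [closedBall_eq_Icc_fin_two _ zero_le_one]
  congr 1 <;> ext <;> simp

theorem scaleMeas_translateMeas_Icc (μ : Measure (Fin 2 → ℝ)) (z a b : Fin 2 → ℝ) (t : ℝ) :
    scaleMeas t (translateMeas z μ) (Icc a b) = μ (scaledBox z a b t) := by
  rw [scaleMeas, translateMeas, Measure.map_map (by fun_prop) (by fun_prop),
    Measure.map_apply (by fun_prop) measurableSet_Icc]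
  congr 1
  ext y
  simp only [mem_preimage, Function.comp_apply, scaledBox, mem_Icc, Pi.le_def, Pi.smul_apply,
    Pi.sub_apply, smul_eq_mul, Real.exp_neg]
  have h := Real.exp_pos t
  refine and_congr (forall_congr' fun i => ?_) (forall_congr' fun i => ?_)
  · rw [← div_le_iff₀' h, ← le_sub_iff_add_le', div_eq_inv_mul]
  · rw [← le_div_iff₀' h, sub_le_iff_le_add', div_eq_inv_mul]

theorem scenery_real_box {μ : Measure (Fin 2 → ℝ)} [IsFiniteMeasure μ] {z : Fin 2 → ℝ} {t : ℝ}
    (h0 : μ (Metric.closedBall z (Real.exp (-t))) ≠ 0) {a b : Fin 2 → ℝ} (ha : -1 ≤ a)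
    (hb : b ≤ 1) :
    (scenery μ z t : Measure (Metric.closedBall (0 : Fin 2 → ℝ) 1)).real
      (Subtype.val ⁻¹' Icc a b) = μ.real (scaledBox z a b t) / μ.real (scaledBox z (-1) 1 t) := by
  have hball : scaleMeas t (translateMeas z μ) (Metric.closedBall 0 1) =
      μ (scaledBox z (-1) 1 t) := by
    rw [closedBall_zero_one_eq_Icc, scaleMeas_translateMeas_Icc]
  rw [scenery, boxNorm_real_apply, measureReal_def, measureReal_def, hball,
    scaleMeas_translateMeas_Icc]
  · rfl
  · rwa [hball, scaledBox_neg_one_one]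
  · rw [hball]; exact measure_ne_top _ _
  · rw [closedBall_zero_one_eq_Icc]; exact Icc_subset_Icc ha hb

theorem boxNorm_normLebesgue_real_box {a b : Fin 2 → ℝ} (ha : -1 ≤ a) (hab : a ≤ b) (hb : b ≤ 1) :
    (boxNorm (normLebesgue 2) : Measure (Metric.closedBall (0 : Fin 2 → ℝ) 1)).real
      (Subtype.val ⁻¹' Icc a b) = (b 0 - a 0) * (b 1 - a 1) / 4 := by
  rw [boxNorm_real_apply, measureReal_def _ (Metric.closedBall _ _), normLebesgue_unitBall,
    normLebesgue, measureReal_ennreal_smul_apply, measureReal_def, Real.volume_Icc_pi_toReal hab,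
    Real.volume_pi_closedBall _ zero_le_one, Fin.prod_univ_two]
  · norm_num
    ring
  · rw [normLebesgue_unitBall]; exact one_ne_zero
  · rw [normLebesgue_unitBall]; exact ENNReal.one_ne_top
  · rw [closedBall_zero_one_eq_Icc]; exact Icc_subset_Icc ha hb

/-- Convergence on boxes implies weak convergence. -/
theorem tendsto_probabilityMeasure_of_boxes {ι : Type*} {l : Filter ι} [l.IsCountablyGenerated]
    {ν : ι → ProbabilityMeasure (Metric.closedBall (0 : Fin 2 → ℝ) 1)}
    {ν₀ : ProbabilityMeasure (Metric.closedBall (0 : Fin 2 → ℝ) 1)}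
    (h : ∀ a b : Fin 2 → ℝ, -1 ≤ a → a ≤ b → b ≤ 1 →
      Tendsto (fun i => (ν i : Measure (Metric.closedBall (0 : Fin 2 → ℝ) 1)).real
        (Subtype.val ⁻¹' Icc a b)) l
        (𝓝 ((ν₀ : Measure (Metric.closedBall (0 : Fin 2 → ℝ) 1)).real
          (Subtype.val ⁻¹' Icc a b)))) :
    Tendsto ν l (𝓝 ν₀) := by
  set S : Set (Set (Metric.closedBall (0 : Fin 2 → ℝ) 1)) :=
    {s | ∃ a b : Fin 2 → ℝ, -1 ≤ a ∧ a ≤ b ∧ b ≤ 1 ∧ s = Subtype.val ⁻¹' Icc a b}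
  have hS : IsPiSystem S := by
    rintro _ ⟨a, b, ha, hab, hb, rfl⟩ _ ⟨a', b', ha', hab', hb', rfl⟩ hne
    rw [← preimage_inter, Icc_inter_Icc] at hne ⊢
    obtain ⟨x, hx⟩ := hne
    exact ⟨_, _, ha.trans le_sup_left, hx.1.trans hx.2, inf_le_left.trans hb, rfl⟩
  refine hS.tendsto_probabilityMeasure_of_tendsto_of_mem ?_ ?_ ?_
  · rintro _ ⟨a, b, -, -, -, rfl⟩
    exact measurable_subtype_coe measurableSet_Icc
  · intro u hu x hx
    obtain ⟨ε, hε, hsub⟩ := Metric.nhds_basis_closedBall.mem_iff.1 (hu.mem_nhds hx)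
    have hx1 : (x : Fin 2 → ℝ) ∈ Icc (-1 : Fin 2 → ℝ) 1 := closedBall_zero_one_eq_Icc ▸ x.2
    -- In the sup norm a ball of the cube is the trace of a box; cutting it down to the cube keeps
    -- it in the family `S`.
    have heq : Subtype.val ⁻¹' Icc ((-1) ⊔ fun i => (x : Fin 2 → ℝ) i - ε)
        (1 ⊓ fun i => (x : Fin 2 → ℝ) i + ε) = Metric.closedBall x ε := by
      rw [← Icc_inter_Icc, ← closedBall_zero_one_eq_Icc, ← closedBall_eq_Icc_fin_two _ hε.le]
      ext y
      exact ⟨fun hy => hy.2, fun hy => ⟨y.2, hy⟩⟩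
    refine ⟨_, ⟨_, _, le_sup_left, ?_, inf_le_left, heq.symm⟩, Metric.closedBall_mem_nhds x hε,
      hsub⟩
    refine le_inf (sup_le (hx1.1.trans hx1.2) fun i => ?_) (sup_le (fun i => ?_) fun i => ?_)
    · exact (sub_le_self _ hε.le).trans (hx1.2 i)
    · exact (hx1.1 i).trans (le_add_of_nonneg_right hε.le)
    · exact (sub_le_self _ hε.le).trans (le_add_of_nonneg_right hε.le)
  · rintro _ ⟨a, b, ha, hab, hb, rfl⟩
    have := h a b ha hab hb
    rw [← NNReal.tendsto_coe]
    simpa using this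

theorem eventually_le_iff_of_continuous {f : ℝ → ℝ} (hf : Continuous f) {t₀ c : ℝ}
    (h : f t₀ ≠ c) : ∀ᶠ t in 𝓝 t₀, (f t ≤ c ↔ f t₀ ≤ c) ∧ (c ≤ f t ↔ c ≤ f t₀) := by
  rcases lt_or_gt_of_ne h with h | h
  · filter_upwards [(hf.tendsto t₀).eventually (gt_mem_nhds h)] with t ht
    exact ⟨iff_of_true ht.le h.le, iff_of_false ht.not_ge h.not_ge⟩
  · filter_upwards [(hf.tendsto t₀).eventually (lt_mem_nhds h)] with t ht
    exact ⟨iff_of_false ht.not_ge h.not_ge, iff_of_true ht.le h.le⟩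

/-- Almost every point avoids the axis-parallel lines bounding the box at time `t₀`, so its
membership in the box is constant for `t` near `t₀`; dominated convergence applies. -/
theorem continuous_codedMeasure_scaledBox (z a b : Fin 2 → ℝ) :
    Continuous fun t => codedMeasure.real (scaledBox z a b t) := by
  refine continuous_iff_continuousAt.2 fun t₀ => ?_
  refine (ENNReal.tendsto_toReal (measure_ne_top _ _)).comp
    (tendsto_measure_of_ae_tendsto_indicator_of_isFiniteMeasure _ (measurableSet_scaledBox _ _ _ _)
      (fun t => measurableSet_scaledBox z a b t) ?_)
  have hline : ∀ (i : Fin 2) (c : ℝ), ∀ᵐ y ∂codedMeasure, c ≠ y i := fun i c => by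
    have : ∀ᵐ y ∂codedMeasure, ¬y i = c := by
      rw [ae_iff]; simpa using codedMeasure_line i c
    exact this.mono fun y hy h => hy h.symm
  have hall : ∀ᵐ y ∂codedMeasure, ∀ i, z i + Real.exp (-t₀) * a i ≠ y i ∧
      z i + Real.exp (-t₀) * b i ≠ y i := ae_all_iff.2 fun i => (hline i _).and (hline i _)
  filter_upwards [hall] with y hy
  have hev : ∀ i, ∀ᶠ t in 𝓝 t₀,
      (z i + Real.exp (-t) * a i ≤ y i ↔ z i + Real.exp (-t₀) * a i ≤ y i) ∧
      (y i ≤ z i + Real.exp (-t) * b i ↔ y i ≤ z i + Real.exp (-t₀) * b i) := fun i => by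
    have h1 := eventually_le_iff_of_continuous
      (f := fun t => z i + Real.exp (-t) * a i) (by fun_prop) (hy i).1
    have h2 := eventually_le_iff_of_continuous
      (f := fun t => z i + Real.exp (-t) * b i) (by fun_prop) (hy i).2
    filter_upwards [h1, h2] with t h1 h2
    exact ⟨h1.1, h2.2⟩
  filter_upwards [eventually_all.2 hev] with t ht
  simp only [scaledBox, mem_Icc, Pi.le_def]
  exact and_congr (forall_congr' fun i => (ht i).1) (forall_congr' fun i => (ht i).2)

theorem codedMeasure_closedBall_ne_zero (w : Seqs) {r : ℝ} (hr : 0 < r) :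
    codedMeasure (Metric.closedBall (codedPoint w) r) ≠ 0 :=
  ((Metric.nhds_basis_closedBall.mem_measureSupport).1 (codedPoint_mem_support w) r hr).ne'

theorem continuous_scenery_codedMeasure (w : Seqs) :
    Continuous (scenery codedMeasure (codedPoint w)) := by
  refine continuous_iff_continuousAt.2 fun t₀ => ?_
  refine tendsto_probabilityMeasure_of_boxes fun a b ha _ hb => ?_
  have h0 : ∀ t, codedMeasure (Metric.closedBall (codedPoint w) (Real.exp (-t))) ≠ 0 := fun t =>
    codedMeasure_closedBall_ne_zero w (Real.exp_pos _)
  simp only [scenery_real_box (h0 _) ha hb]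
  refine ((continuous_codedMeasure_scaledBox _ a b).tendsto t₀).div
    ((continuous_codedMeasure_scaledBox _ _ _).tendsto t₀) ?_
  rw [scaledBox_neg_one_one]
  exact fun h => h0 t₀ ((measureReal_eq_zero_iff (measure_ne_top _ _)).1 h)

/-! ### The scenery between coding scales -/

theorem not_isCoding_of_mem {j l : ℕ} (h1 : 2 ^ j + 1 ≤ l) (h2 : l < 2 ^ j + 1 + (2 ^ j - 1)) :
    ¬IsCoding l := by
  intro h
  have h3 : 2 ^ j < 2 ^ Nat.log 2 l := by rw [h]; omega
  have h4 : 2 ^ Nat.log 2 l < 2 ^ (j + 1) := by rw [h, pow_succ]; omega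
  have h5 := (Nat.pow_lt_pow_iff_right Nat.one_lt_two).1 h3
  have h6 := (Nat.pow_lt_pow_iff_right Nat.one_lt_two).1 h4
  omega

/-- The times corresponding to scales well between the `j`-th and the next coding position. -/
noncomputable def goodTimes (j : ℕ) : Set ℝ :=
  Icc ((2 ^ j + 1 + j) * Real.log 2) ((2 ^ (j + 1) - j) * Real.log 2)

/-- The set of points that, within their dyadic cell of level `2 ^ j + 1`, are at relative distance
at least `2 ^ (-j)` from the boundary of that cell. -/
noncomputable def centralPoints (j : ℕ) : Set (Fin 2 → ℝ) :=
  {z | ∀ i, ((2 : ℝ) ^ j)⁻¹ ≤ Int.fract (z i * 2 ^ (2 ^ j + 1)) ∧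
    Int.fract (z i * 2 ^ (2 ^ j + 1)) ≤ 1 - ((2 : ℝ) ^ j)⁻¹}

theorem measurableSet_centralPoints (j : ℕ) : MeasurableSet (centralPoints j) := by
  have hm : ∀ i : Fin 2, Measurable fun z : Fin 2 → ℝ => Int.fract (z i * 2 ^ (2 ^ j + 1)) :=
    fun i => measurable_fract.comp (by fun_prop)
  have h : centralPoints j =
      ⋂ i, ({z | ((2 : ℝ) ^ j)⁻¹ ≤ Int.fract (z i * 2 ^ (2 ^ j + 1))} ∩
        {z | Int.fract (z i * 2 ^ (2 ^ j + 1)) ≤ 1 - ((2 : ℝ) ^ j)⁻¹}) := by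
    ext z; simp only [centralPoints, mem_ofPred_eq, mem_iInter, mem_inter_iff]
  rw [h]
  exact MeasurableSet.iInter fun i => (measurableSet_le measurable_const (hm i)).inter
    (measurableSet_le (hm i) measurable_const)

theorem trunc_bounds_of_fract {d : ℕ → Fin 2} {p : ℕ} {ε : ℝ} (hε : 0 < ε)
    (h1 : ε ≤ Int.fract (Real.ofDigits d * 2 ^ p))
    (h2 : Int.fract (Real.ofDigits d * 2 ^ p) ≤ 1 - ε) :
    trunc d p + ε ≤ Real.ofDigits d * 2 ^ p ∧ Real.ofDigits d * 2 ^ p ≤ trunc d p + 1 - ε := by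
  have h3 := ofDigits_eq_trunc d p
  set u := Real.ofDigits fun i => d (i + p)
  have hu0 : 0 ≤ u := Real.ofDigits_nonneg _
  -- A tail of all ones would put the point on the right end of its cell, where the fractional part
  -- is 0 rather than at least `ε`.
  have hu1 : u < 1 := by
    refine lt_of_le_of_ne (Real.ofDigits_le_one _) fun hu => ?_
    rw [h3, hu] at h1
    have : Int.fract ((trunc d p : ℝ) + 1) = 0 := by
      rw [← Nat.cast_add_one, Int.fract_natCast]
    linarith
  rw [h3, Int.fract_natCast_add, Int.fract_eq_self.2 ⟨hu0, hu1⟩] at h1 h2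
  constructor <;> linarith

/-- `N` is the radius of the window measured in cells of level `2 ^ (j + 1)`. The upper end of
`goodTimes j` makes `N` large; the lower end makes the radius at most `2 ^ (-j)` times the side of
the cell of level `2 ^ j + 1`, so that the window about a central point stays inside this cell. No
coding position lies between these levels, so the mass is that of one cell times a lattice count. -/
theorem scaledBox_bounds {j : ℕ} {w : Seqs} (hw : codedPoint w ∈ centralPoints j) {t : ℝ}
    (ht : t ∈ goodTimes j) {a b : Fin 2 → ℝ} (ha : -1 ≤ a) (hab : a ≤ b) (hb : b ≤ 1) :
    let N := Real.exp (-t) * 2 ^ 2 ^ (j + 1)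
    2 ^ j ≤ N ∧
    codedMeasure.real (scaledBox (codedPoint w) a b t) ≤
      cellMass (2 ^ (j + 1)) * (((b 0 - a 0) * N + 2) * ((b 1 - a 1) * N + 2)) ∧
    cellMass (2 ^ (j + 1)) * (max 0 ((b 0 - a 0) * N - 2) * max 0 ((b 1 - a 1) * N - 2)) ≤
      codedMeasure.real (scaledBox (codedPoint w) a b t) := by
  intro N
  have he := Real.exp_pos (-t)
  have hsub : ∀ i, (codedPoint w i + Real.exp (-t) * b i -
      (codedPoint w i + Real.exp (-t) * a i)) * 2 ^ 2 ^ (j + 1) = (b i - a i) * N := fun i => by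
    simp only [N]; ring
  have hlog : Real.exp (Real.log 2) = 2 := Real.exp_log two_pos
  refine ⟨?_, ?_, ?_⟩
  · have h1 : t + j * Real.log 2 ≤ ((2 ^ (j + 1) : ℕ) : ℝ) * Real.log 2 := by
      have := ht.2; push_cast; linarith
    have h2 := Real.exp_le_exp.2 h1
    rw [Real.exp_add, Real.exp_nat_mul, Real.exp_nat_mul, hlog] at h2
    have h3 : Real.exp (-t) * (Real.exp t * 2 ^ j) ≤ N := mul_le_mul_of_nonneg_left h2 he.le
    rwa [← mul_assoc, ← Real.exp_add, neg_add_cancel, Real.exp_zero, one_mul] at h3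
  · have h := codedMeasure_real_Icc_le (2 ^ (j + 1))
      (a := fun i => codedPoint w i + Real.exp (-t) * a i)
      (b := fun i => codedPoint w i + Real.exp (-t) * b i)
      (fun i => add_le_add_right (mul_le_mul_of_nonneg_left (hab i) he.le) _)
    rwa [hsub, hsub] at h
  · have hpk : 2 ^ j + 1 + (2 ^ j - 1) = 2 ^ (j + 1) := by
      have := Nat.one_le_two_pow (n := j); rw [pow_succ]; omega
    have hsmall : Real.exp (-t) * 2 ^ (2 ^ j + 1) ≤ ((2 : ℝ) ^ j)⁻¹ := by
      have h1 : ((2 ^ j + 1 : ℕ) : ℝ) * Real.log 2 + j * Real.log 2 ≤ t := by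
        have := ht.1; push_cast; linarith
      have h2 := Real.exp_le_exp.2 h1
      rw [Real.exp_add, Real.exp_nat_mul, Real.exp_nat_mul, hlog] at h2
      have h3 := mul_le_mul_of_nonneg_left h2 he.le
      rw [← Real.exp_add, neg_add_cancel, Real.exp_zero, ← mul_assoc] at h3
      rwa [← one_div, le_div_iff₀ (by positivity)]
    have hpj : (0 : ℝ) < (2 ^ j)⁻¹ := by positivity
    have hbd : ∀ i, ∀ d : ℕ → Fin 2, codedPoint w i = Real.ofDigits d →
        (trunc d (2 ^ j + 1) : ℝ) ≤
          (codedPoint w i + Real.exp (-t) * a i) * 2 ^ (2 ^ j + 1) ∧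
        (codedPoint w i + Real.exp (-t) * b i) * 2 ^ (2 ^ j + 1) ≤
          trunc d (2 ^ j + 1) + 1 := fun i d hd => by
      have hwi := hw i
      rw [hd] at hwi ⊢
      obtain ⟨h1, h2⟩ := trunc_bounds_of_fract hpj hwi.1 hwi.2
      have h3 : 0 < Real.exp (-t) * 2 ^ (2 ^ j + 1) := by positivity
      have h4 : Real.exp (-t) * 2 ^ (2 ^ j + 1) * -1 ≤ Real.exp (-t) * 2 ^ (2 ^ j + 1) * a i :=
        mul_le_mul_of_nonneg_left (ha i) h3.le
      have h5 : Real.exp (-t) * 2 ^ (2 ^ j + 1) * b i ≤ Real.exp (-t) * 2 ^ (2 ^ j + 1) * 1 :=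
        mul_le_mul_of_nonneg_left (hb i) h3.le
      constructor <;> linarith
    have hx := hbd 0 (xDigit w) rfl
    have hy := hbd 1 (yDigit w) rfl
    have h := le_codedMeasure_real_Icc (p := 2 ^ j + 1) (k := 2 ^ j - 1)
      (fun l h1 h2 => not_isCoding_of_mem h1 h2) w
      (a := fun i => codedPoint w i + Real.exp (-t) * a i)
      (b := fun i => codedPoint w i + Real.exp (-t) * b i) hx.1 hx.2 hy.1 hy.2
    rwa [hpk, hsub, hsub] at h

theorem tendsto_linear_div_linear (β c c' : ℝ) :
    Tendsto (fun N : ℝ => (β * N + c) / (2 * N + c')) atTop (𝓝 (β / 2)) := by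
  have h : ∀ γ e : ℝ, Tendsto (fun N : ℝ => γ + e / N) atTop (𝓝 (γ + 0)) := fun γ e =>
    tendsto_const_nhds.add (tendsto_const_nhds.div_atTop tendsto_id)
  have h1 := (h β c).div (h 2 c') (by norm_num)
  simp only [add_zero] at h1
  refine h1.congr' ?_
  filter_upwards [eventually_gt_atTop 0] with N hN
  simp only [Pi.div_apply]
  rw [← mul_div_mul_right _ _ hN.ne', add_mul, add_mul, div_mul_cancel₀ _ hN.ne',
    div_mul_cancel₀ _ hN.ne']

/-- In the ratio giving the scenery mass of a box, the unknown cell mass cancels. What remains is a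
ratio of lattice counts, squeezed between `L N` and `U N`, and `N` tends to infinity along good
times. -/
theorem tendsto_scenery_goodTimes {w : Seqs} (hw : ∀ᶠ j in atTop, codedPoint w ∈ centralPoints j) :
    Tendsto (scenery codedMeasure (codedPoint w)) (atTop ⊓ 𝓟 (⋃ j, goodTimes j))
      (𝓝 (boxNorm (normLebesgue 2))) := by
  refine tendsto_probabilityMeasure_of_boxes fun a b ha hab hb => ?_
  have h0 : ∀ t, codedMeasure (Metric.closedBall (codedPoint w) (Real.exp (-t))) ≠ 0 := fun t =>
    codedMeasure_closedBall_ne_zero w (Real.exp_pos _)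
  simp only [scenery_real_box (h0 _) ha hb, boxNorm_normLebesgue_real_box ha hab hb]
  set β := b 0 - a 0
  set γ := b 1 - a 1
  have hβ : 0 ≤ β := sub_nonneg.2 (hab 0)
  have hγ : 0 ≤ γ := sub_nonneg.2 (hab 1)
  set q := fun t => codedMeasure.real (scaledBox (codedPoint w) a b t) /
    codedMeasure.real (scaledBox (codedPoint w) (-1) 1 t)
  set U : ℝ → ℝ := fun N => (β * N + 2) / (2 * N + -2) * ((γ * N + 2) / (2 * N + -2))
  set L : ℝ → ℝ := fun N => max 0 ((β * N + -2) / (2 * N + 2)) * max 0 ((γ * N + -2) / (2 * N + 2))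
  have hU : Tendsto U atTop (𝓝 (β * γ / 4)) := by
    have := (tendsto_linear_div_linear β 2 (-2)).mul (tendsto_linear_div_linear γ 2 (-2))
    rwa [show β / 2 * (γ / 2) = β * γ / 4 by ring] at this
  have hL : Tendsto L atTop (𝓝 (β * γ / 4)) := by
    have := ((tendsto_const_nhds (x := (0 : ℝ))).max (tendsto_linear_div_linear β (-2) 2)).mul
      ((tendsto_const_nhds (x := (0 : ℝ))).max (tendsto_linear_div_linear γ (-2) 2))
    rwa [max_eq_right (by positivity), max_eq_right (by positivity),
      show β / 2 * (γ / 2) = β * γ / 4 by ring] at this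
  have key : ∀ N₀ : ℝ, ∀ᶠ t in atTop ⊓ 𝓟 (⋃ j, goodTimes j),
      ∃ N ≥ N₀, L N ≤ q t ∧ q t ≤ U N := by
    intro N₀
    obtain ⟨J₀, hJ₀⟩ := eventually_atTop.1 hw
    obtain ⟨J₁, hJ₁⟩ := pow_unbounded_of_one_lt (max N₀ 1) (one_lt_two (α := ℝ))
    set J := max J₀ J₁
    rw [eventually_inf_principal]
    filter_upwards [eventually_gt_atTop ((2 : ℝ) ^ J * Real.log 2)] with t ht htG
    obtain ⟨j, hj⟩ := mem_iUnion.1 htG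
    -- A late good time belongs to a large index, since `goodTimes j` ends before `2 ^ (j + 1) * log
    -- 2`.
    have hJj : J ≤ j := by
      by_contra! hlt
      have h1 : ((2 : ℝ) ^ (j + 1) - j) * Real.log 2 ≤ 2 ^ J * Real.log 2 := by
        refine mul_le_mul_of_nonneg_right ?_ (Real.log_nonneg one_le_two)
        have h2 : (2 : ℝ) ^ (j + 1) ≤ 2 ^ J := pow_le_pow_right₀ one_le_two hlt
        have h3 : (0 : ℝ) ≤ j := Nat.cast_nonneg j
        linarith
      exact absurd hj.2 (not_le.2 (h1.trans_lt ht))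
    have hcen := hJ₀ j ((le_max_left _ _).trans hJj)
    obtain ⟨hN, hu, hl⟩ := scaledBox_bounds hcen hj ha hab hb
    obtain ⟨-, hu1, hl1⟩ := scaledBox_bounds hcen hj (a := -1) (b := 1) le_rfl
      (fun _ => by norm_num) le_rfl
    set N := Real.exp (-t) * 2 ^ 2 ^ (j + 1)
    have hpow : (2 : ℝ) ^ J₁ ≤ 2 ^ j :=
      pow_le_pow_right₀ one_le_two ((le_max_right _ _).trans hJj)
    have hNmax : max N₀ 1 < N := hJ₁.trans_le (hpow.trans hN)
    have hN1 : 1 < N := (le_max_right _ _).trans_lt hNmax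
    have hM := cellMass_pos (2 ^ (j + 1))
    set M := cellMass (2 ^ (j + 1))
    norm_num at hu1 hl1
    rw [max_eq_right (show (0 : ℝ) ≤ 2 * N - 2 by linarith)] at hl1
    have hpos : 0 < 2 * N + -2 := by linarith
    have hball : 0 < codedMeasure.real (scaledBox (codedPoint w) (-1) 1 t) :=
      lt_of_lt_of_le (mul_pos hM (mul_pos (by linarith) (by linarith))) hl1
    refine ⟨N, ((le_max_left _ _).trans_lt hNmax).le, ?_, ?_⟩
    · have h2 : L N = M * (max 0 (β * N - 2) * max 0 (γ * N - 2)) /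
          (M * ((2 * N + 2) * (2 * N + 2))) := by
        have h3 : ∀ x : ℝ, max 0 (x / (2 * N + 2)) = max 0 x / (2 * N + 2) := fun x => by
          rw [← max_div_div_right (by linarith), zero_div]
        simp only [L, h3, ← sub_eq_add_neg]
        rw [div_mul_div_comm, mul_div_mul_left _ _ hM.ne']
      rw [h2]
      exact div_le_div₀ measureReal_nonneg hl hball hu1
    · have h2 : U N = M * ((β * N + 2) * (γ * N + 2)) / (M * ((2 * N - 2) * (2 * N - 2))) := by
        simp only [U, ← sub_eq_add_neg]
        rw [div_mul_div_comm, mul_div_mul_left _ _ hM.ne']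
      rw [h2]
      exact div_le_div₀ (by positivity) hu
        (mul_pos hM (mul_pos (by linarith) (by linarith))) hl1
  refine tendsto_order.2 ⟨fun x hx => ?_, fun x hx => ?_⟩
  · obtain ⟨N₀, hN₀⟩ := eventually_atTop.1 ((tendsto_order.1 hL).1 x hx)
    filter_upwards [key N₀] with t ⟨N, hN, h1, _⟩
    exact (hN₀ N hN).trans_le h1
  · obtain ⟨N₀, hN₀⟩ := eventually_atTop.1 ((tendsto_order.1 hU).2 x hx)
    filter_upwards [key N₀] with t ⟨N, hN, _, h2⟩
    exact h2.trans_lt (hN₀ N hN)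

/-! ### Typical points are central -/

theorem fairCoins_real_forall_eq (s : Finset ℕ) (e : Fin 2) :
    fairCoins.real {w | ∀ i ∈ s, (w i).1 = e} = (1 / 2) ^ s.card ∧
      fairCoins.real {w | ∀ i ∈ s, (w i).2 = e} = (1 / 2) ^ s.card := by
  have e1 : {w : Seqs | ∀ i ∈ s, (w i).1 = e} = Set.pi s fun _ =>
      ((({e} : Finset (Fin 2)) ×ˢ Finset.univ : Finset (Fin 2 × Fin 2)) : Set (Fin 2 × Fin 2)) := by
    ext w
    simp only [mem_ofPred_eq, Set.mem_pi, Finset.mem_coe, Finset.mem_product, Finset.mem_singleton,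
      Finset.mem_univ, and_true]
  have e2 : {w : Seqs | ∀ i ∈ s, (w i).2 = e} = Set.pi s fun _ =>
      ((Finset.univ ×ˢ ({e} : Finset (Fin 2)) : Finset (Fin 2 × Fin 2)) : Set (Fin 2 × Fin 2)) := by
    ext w
    simp only [mem_ofPred_eq, Set.mem_pi, Finset.mem_coe, Finset.mem_product, Finset.mem_singleton,
      Finset.mem_univ, true_and]
  rw [e1, e2, fairCoins_real_pi, fairCoins_real_pi]
  simp only [Finset.card_product, Finset.card_singleton, Finset.card_univ, Fintype.card_fin,
    Finset.prod_const]
  norm_num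

/-- The event that the digits of some coordinate are constant right after the `j`-th coding
position. -/
def constantRun (j : ℕ) : Set Seqs :=
  ⋃ e : Fin 2, {w | ∀ i ∈ Finset.Ico (2 ^ j + 1) (2 ^ j + 1 + j), (w i).1 = e} ∪
    {w | ∀ i ∈ Finset.Ico (2 ^ j + 1) (2 ^ j + 1 + j), (w i).2 = e}

theorem fairCoins_constantRun_le (j : ℕ) :
    fairCoins (constantRun j) ≤ ENNReal.ofReal (4 * (1 / 2) ^ j) := by
  rw [← ofReal_measureReal]
  refine ENNReal.ofReal_le_ofReal ?_
  refine (measureReal_iUnion_fintype_le _).trans ?_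
  have h : ∀ e : Fin 2, fairCoins.real
      ({w | ∀ i ∈ Finset.Ico (2 ^ j + 1) (2 ^ j + 1 + j), (w i).1 = e} ∪
        {w | ∀ i ∈ Finset.Ico (2 ^ j + 1) (2 ^ j + 1 + j), (w i).2 = e}) ≤ 2 * (1 / 2) ^ j := by
    intro e
    refine (measureReal_union_le _ _).trans ?_
    have h := fairCoins_real_forall_eq (Finset.Ico (2 ^ j + 1) (2 ^ j + 1 + j)) e
    rw [Nat.card_Ico, Nat.add_sub_cancel_left] at h
    rw [h.1, h.2, two_mul]
  refine (Finset.sum_le_sum fun e _ => h e).trans_eq ?_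
  rw [Finset.sum_const, Finset.card_univ, Fintype.card_fin, nsmul_eq_mul]
  push_cast
  ring

/-- Among the `j` digits after position `2 ^ j`, a one keeps the fractional part at least `2 ^ (-j)`
from 0, and a zero keeps it as far from 1. These positions are not coding, because `j ≤ 2 ^ j - 1`,
so the digits of `x` there are free coins. -/
theorem codedPoint_mem_centralPoints {w : Seqs} {j : ℕ} (hw : w ∉ constantRun j) :
    codedPoint w ∈ centralPoints j := by
  simp only [constantRun, mem_iUnion, mem_union, mem_ofPred_eq, not_exists, not_or, not_forall,
    Finset.mem_Ico] at hw
  have key : ∀ d : ℕ → Fin 2, (∀ e, ∃ i, ∃ _ : 2 ^ j + 1 ≤ i ∧ i < 2 ^ j + 1 + j, ¬d i = e) →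
      ((2 : ℝ) ^ j)⁻¹ ≤ Int.fract (Real.ofDigits d * 2 ^ (2 ^ j + 1)) ∧
        Int.fract (Real.ofDigits d * 2 ^ (2 ^ j + 1)) ≤ 1 - ((2 : ℝ) ^ j)⁻¹ := by
    intro d hd
    set u := Real.ofDigits fun i => d (i + (2 ^ j + 1))
    have h1 : ((2 : ℝ) ^ j)⁻¹ ≤ u := by
      obtain ⟨i, ⟨hi1, hi2⟩, hi⟩ := hd 0
      refine inv_pow_le_ofDigits (i := i - (2 ^ j + 1)) (by omega) ?_
      simp only [Nat.sub_add_cancel hi1]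
      generalize d i = e at *
      fin_cases e <;> simp_all
    have h2 : u ≤ 1 - ((2 : ℝ) ^ j)⁻¹ := by
      obtain ⟨i, ⟨hi1, hi2⟩, hi⟩ := hd 1
      refine ofDigits_le_one_sub (i := i - (2 ^ j + 1)) (by omega) ?_
      simp only [Nat.sub_add_cancel hi1]
      generalize d i = e at *
      fin_cases e <;> simp_all
    have h3 : (0 : ℝ) < (2 ^ j)⁻¹ := by positivity
    rw [ofDigits_eq_trunc, Int.fract_natCast_add, Int.fract_eq_self.2 ⟨by linarith, by linarith⟩]
    exact ⟨h1, h2⟩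
  have hx : ∀ i, 2 ^ j + 1 ≤ i → i < 2 ^ j + 1 + j → xDigit w i = (w i).1 := fun i h1 h2 =>
    xDigit_of_not_isCoding w (not_isCoding_of_mem h1 (by
      have := Nat.lt_two_pow_self (n := j); omega))
  rw [centralPoints, mem_ofPred_eq, Fin.forall_fin_two]
  refine ⟨key (xDigit w) fun e => ?_, key (yDigit w) fun e => (hw e).2⟩
  obtain ⟨i, hi, hne⟩ := (hw e).1
  exact ⟨i, hi, by rwa [hx i hi.1 hi.2]⟩

/-- Borel-Cantelli: the probabilities of `constantRun j` are bounded by a convergent geometric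
series. -/
theorem ae_eventually_mem_centralPoints :
    ∀ᵐ z ∂codedMeasure, ∀ᶠ j in atTop, z ∈ centralPoints j := by
  have hms : MeasurableSet {z : Fin 2 → ℝ | ∀ᶠ j in atTop, z ∈ centralPoints j} := by
    have : {z : Fin 2 → ℝ | ∀ᶠ j in atTop, z ∈ centralPoints j} =
        liminf centralPoints atTop := by
      ext z; rw [mem_liminf_iff_eventually_mem]; rfl
    rw [this]
    exact MeasurableSet.measurableSet_liminf measurableSet_centralPoints
  refine (ae_map_iff measurable_codedPoint.aemeasurable hms).2 ?_
  have hsum : ∑' j, fairCoins (constantRun j) ≠ ⊤ := by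
    have h1 : Summable fun j : ℕ => 4 * (1 / 2 : ℝ) ^ j :=
      (summable_geometric_of_lt_one (by norm_num) (by norm_num)).mul_left 4
    refine ne_top_of_le_ne_top ?_ (ENNReal.tsum_le_tsum fairCoins_constantRun_le)
    rw [← ENNReal.ofReal_tsum_of_nonneg (fun j => by positivity) h1]
    exact ENNReal.ofReal_ne_top
  filter_upwards [ae_eventually_notMem hsum] with w hw
  exact hw.mono fun j hj => codedPoint_mem_centralPoints hj

/-! ### Time averages -/

theorem measurableSet_iUnion_goodTimes : MeasurableSet (⋃ j, goodTimes j) :=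
  MeasurableSet.iUnion fun _ => measurableSet_Icc

/-- The bad times around `2 ^ (J + 1) * log 2` form an interval of length `(2 * J + 2) * log 2`;
these lengths add up quadratically in `J`. -/
theorem volume_diff_goodTimes_le (J : ℕ) :
    volume.real (Icc 0 ((2 ^ J + 1 + J) * Real.log 2) \ ⋃ j, goodTimes j) ≤ ((J : ℝ) + 2) ^ 2 := by
  have hlog0 : 0 < Real.log 2 := Real.log_pos one_lt_two
  have hlog1 : Real.log 2 ≤ 1 := by linarith [Real.log_two_lt_d9]
  induction J with
  | zero =>
    refine (measureReal_mono sdiff_subset measure_Icc_lt_top.ne).trans ?_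
    rw [Real.volume_real_Icc_of_le (by positivity)]
    norm_num
    linarith
  | succ J ih =>
    set s := (2 ^ J + 1 + J) * Real.log 2 with hs
    set e := (2 ^ (J + 1) - J) * Real.log 2 with he
    set s' := (2 ^ (J + 1) + 1 + ((J + 1 : ℕ) : ℝ)) * Real.log 2 with hs'
    have hes : s' - e = (2 * J + 2) * Real.log 2 := by rw [hs', he]; push_cast; ring
    have hsub : Icc 0 s' \ ⋃ j, goodTimes j ⊆ (Icc 0 s \ ⋃ j, goodTimes j) ∪ Icc e s' := by
      rintro t ⟨ht, htG⟩
      by_cases h1 : t ≤ s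
      · exact Or.inl ⟨⟨ht.1, h1⟩, htG⟩
      · refine Or.inr ⟨?_, ht.2⟩
        by_contra! h2
        exact htG (mem_iUnion.2 ⟨J, (not_le.1 h1).le, h2.le⟩)
    have hfin : volume (Icc 0 s \ ⋃ j, goodTimes j) ≠ ⊤ :=
      ne_top_of_le_ne_top (by simp) (measure_mono sdiff_subset)
    refine (measureReal_mono hsub (measure_union_ne_top hfin (by simp))).trans
      ((measureReal_union_le _ _).trans ?_)
    have hee : e ≤ s' := by
      have : 0 ≤ (2 * (J : ℝ) + 2) * Real.log 2 := by positivity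
      linarith
    rw [Real.volume_real_Icc_of_le hee, hes]
    have h3 : (2 * (J : ℝ) + 2) * Real.log 2 ≤ 2 * J + 2 :=
      mul_le_of_le_one_right (by positivity) hlog1
    push_cast
    nlinarith

theorem tendsto_volume_diff_goodTimes_div :
    Tendsto (fun T : ℝ => volume.real (Icc 0 T \ ⋃ j, goodTimes j) / T) atTop (𝓝 0) := by
  have hlim : Tendsto (fun T : ℝ => 4 * (Real.log T ^ 2 / T) + 16 * (Real.log T ^ 1 / T) + 16 / T)
      atTop (𝓝 (4 * 0 + 16 * 0 + 0)) := by
    have h : ∀ n, Tendsto (fun T : ℝ => Real.log T ^ n / T) atTop (𝓝 0) := fun n =>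
      (Real.isLittleO_pow_log_id_atTop (n := n)).tendsto_div_nhds_zero
    exact (((h 2).const_mul 4).add ((h 1).const_mul 16)).add
      (tendsto_const_nhds.div_atTop tendsto_id)
  simp only [mul_zero, add_zero] at hlim
  refine tendsto_of_tendsto_of_tendsto_of_le_of_le' tendsto_const_nhds hlim ?_ ?_
  · filter_upwards [eventually_gt_atTop 0] with T hT
    positivity
  · filter_upwards [eventually_ge_atTop 1] with T hT
    have hT0 : 0 < T := one_pos.trans_le hT
    set k := Nat.log 2 ⌊T⌋₊
    have hlog : 1 / 2 ≤ Real.log 2 := by linarith [Real.log_two_gt_d9]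
    have hfl : ⌊T⌋₊ ≠ 0 := (Nat.floor_pos.2 hT).ne'
    have hk1 : (k : ℝ) ≤ 2 * Real.log T := by
      have h1 : ((2 ^ k : ℕ) : ℝ) ≤ T :=
        (Nat.cast_le.2 (Nat.pow_log_le_self 2 hfl)).trans (Nat.floor_le hT0.le)
      have h2 := Real.log_le_log (by positivity) h1
      push_cast at h2
      rw [Real.log_pow] at h2
      nlinarith [(Nat.cast_nonneg k : (0 : ℝ) ≤ k)]
    -- Although `T < 2 ^ (k + 1)`, the stage `k + 2` is used: the extra factor 2 makes up for `log
    -- 2`, which is only known to be at least 1/2.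
    have hk2 : T ≤ (2 ^ (k + 2) + 1 + ((k + 2 : ℕ) : ℝ)) * Real.log 2 := by
      have h1 : ⌊T⌋₊ + 1 ≤ 2 ^ (k + 1) := Nat.lt_pow_succ_log_self Nat.one_lt_two _
      have h2 : (⌊T⌋₊ : ℝ) + 1 ≤ 2 ^ (k + 1) := by exact_mod_cast h1
      have h3 := Nat.lt_floor_add_one T
      have h4 : (2 : ℝ) ^ (k + 2) = 2 * 2 ^ (k + 1) := by rw [pow_succ]; ring
      have h5 : (0 : ℝ) ≤ ((k + 2 : ℕ) : ℝ) := Nat.cast_nonneg _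
      have h6 : (2 ^ (k + 2) + 1 + ((k + 2 : ℕ) : ℝ)) * (1 / 2) ≤
          (2 ^ (k + 2) + 1 + ((k + 2 : ℕ) : ℝ)) * Real.log 2 :=
        mul_le_mul_of_nonneg_left hlog (by positivity)
      linarith
    have h3 := (measureReal_mono (μ := volume) (sdiff_subset_sdiff_left (Icc_subset_Icc_right hk2))
      (ne_top_of_le_ne_top (by simp) (measure_mono sdiff_subset))).trans
        (volume_diff_goodTimes_le (k + 2))
    have h4 : (((k + 2 : ℕ) : ℝ) + 2) ^ 2 ≤ (2 * Real.log T + 4) ^ 2 := by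
      refine pow_le_pow_left₀ (by positivity) ?_ 2
      push_cast
      linarith
    rw [mul_div_assoc', mul_div_assoc', ← add_div, ← add_div]
    refine div_le_div_of_nonneg_right ((h3.trans h4).trans_eq ?_) hT0.le
    ring

/-- A bounded continuous function that converges along a set of full density converges in
average. -/
theorem tendsto_average_of_tendsto_on_dense {h : ℝ → ℝ} (hc : Continuous h) {C L : ℝ}
    (hC : ∀ t, |h t - L| ≤ C) {G : Set ℝ} (hG : MeasurableSet G)
    (hlim : Tendsto h (atTop ⊓ 𝓟 G) (𝓝 L))
    (hdens : Tendsto (fun T : ℝ => volume.real (Icc 0 T \ G) / T) atTop (𝓝 0)) :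
    Tendsto (fun T : ℝ => T⁻¹ * ∫ t in (0 : ℝ)..T, h t) atTop (𝓝 L) := by
  have hC0 : 0 ≤ C := (abs_nonneg _).trans (hC 0)
  rw [Metric.tendsto_atTop]
  intro ε hε
  have hev : ∀ᶠ t in atTop, t ∈ G → |h t - L| ≤ ε / 3 := by
    rw [← eventually_inf_principal]
    have := (Metric.tendsto_nhds.1 hlim) (ε / 3) (by positivity)
    exact this.mono fun t ht => (Real.dist_eq _ _ ▸ ht).le
  obtain ⟨T₀, hT₀⟩ := eventually_atTop.1 hev
  have h1 : Tendsto (fun T : ℝ => C * (max T₀ 0 / T) + C * (volume.real (Icc 0 T \ G) / T)) atTop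
      (𝓝 (C * 0 + C * 0)) :=
    ((tendsto_const_nhds.div_atTop tendsto_id).const_mul C).add (hdens.const_mul C)
  simp only [mul_zero, add_zero] at h1
  obtain ⟨T₁, hT₁⟩ := eventually_atTop.1 ((tendsto_order.1 h1).2 (ε / 3) (by positivity))
  refine ⟨max T₁ 1, fun T hT => ?_⟩
  have hT1 := hT₁ T ((le_max_left _ _).trans hT)
  have hT0 : 0 < T := one_pos.trans_le ((le_max_right _ _).trans hT)
  have hint : T⁻¹ * (∫ t in (0 : ℝ)..T, h t) - L = T⁻¹ * ∫ t in (0 : ℝ)..T, (h t - L) := by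
    rw [intervalIntegral.integral_sub (hc.intervalIntegrable _ _) intervalIntegrable_const,
      intervalIntegral.integral_const, sub_zero, smul_eq_mul, mul_sub, inv_mul_cancel_left₀ hT0.ne']
  -- On `B`, the early and the bad times, only the bound `C` is available, but `B` occupies a
  -- vanishing proportion of `[0, T]`; off `B` the integrand is at most `ε / 3`.
  set B := Icc 0 (max T₀ 0) ∪ (Icc 0 T \ G) with hB
  have hBm : MeasurableSet B := measurableSet_Icc.union (measurableSet_Icc.diff hG)
  have hBfin : volume B ≠ ⊤ :=
    measure_union_ne_top (by simp) (ne_top_of_le_ne_top (by simp) (measure_mono sdiff_subset))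
  have hvB : volume.real (Ioc 0 T ∩ B) ≤ max T₀ 0 + volume.real (Icc 0 T \ G) := by
    refine (measureReal_mono inter_subset_right hBfin).trans ((measureReal_union_le _ _).trans ?_)
    rw [Real.volume_real_Icc_of_le (le_max_right _ _), sub_zero]
  have hvC : volume.real (Ioc 0 T \ B) ≤ T := by
    refine (measureReal_mono sdiff_subset measure_Ioc_lt_top.ne).trans ?_
    rw [Real.volume_real_Ioc_of_le hT0.le, sub_zero]
  have hI : IntegrableOn (fun t => h t - L) (Ioc 0 T) :=
    ((hc.sub continuous_const).integrableOn_Icc (a := 0) (b := T)).mono_set Ioc_subset_Icc_self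
  have hb1 : ‖∫ t in Ioc 0 T ∩ B, (h t - L)‖ ≤ C * volume.real (Ioc 0 T ∩ B) :=
    norm_setIntegral_le_of_norm_le_const (measure_inter_lt_top_of_right_ne_top hBfin)
      fun t _ => hC t
  have hb2 : ‖∫ t in Ioc 0 T \ B, (h t - L)‖ ≤ ε / 3 * volume.real (Ioc 0 T \ B) := by
    refine norm_setIntegral_le_of_norm_le_const
      ((measure_mono sdiff_subset).trans_lt (by simp)) fun t ht => ?_
    have h2 : max T₀ 0 < t := by
      by_contra! hle
      exact ht.2 (Or.inl ⟨ht.1.1.le, hle⟩)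
    have h3 : t ∈ G := by
      by_contra hG
      exact ht.2 (Or.inr ⟨Ioc_subset_Icc_self ht.1, hG⟩)
    exact hT₀ t ((le_max_left _ _).trans h2.le) h3
  have htot : |∫ t in (0 : ℝ)..T, (h t - L)| ≤
      C * (max T₀ 0 + volume.real (Icc 0 T \ G)) + ε / 3 * T := by
    rw [intervalIntegral.integral_of_le hT0.le, ← integral_inter_add_sdiff hBm hI]
    refine (abs_add_le _ _).trans (add_le_add (hb1.trans ?_) (hb2.trans ?_))
    · exact mul_le_mul_of_nonneg_left hvB hC0
    · exact mul_le_mul_of_nonneg_left hvC (by positivity)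
  rw [Real.dist_eq, hint, abs_mul, abs_of_pos (inv_pos.2 hT0), inv_mul_lt_iff₀ hT0]
  have hmul := mul_lt_mul_of_pos_right hT1 hT0
  rw [add_mul, mul_assoc, mul_assoc, div_mul_cancel₀ _ hT0.ne', div_mul_cancel₀ _ hT0.ne'] at hmul
  have := mul_pos hε hT0
  linarith

theorem generatesAt_codedPoint {w : Seqs} (hw : ∀ᶠ j in atTop, codedPoint w ∈ centralPoints j) :
    GeneratesAt codedMeasure (codedPoint w) (lebesgueEFD 2) := by
  refine ⟨codedPoint_mem_support w, fun F => ?_⟩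
  rw [integral_lebesgueEFD]
  -- Compactness of the ball makes its space of probability measures compact, so the test function
  -- `F` has a finite sup norm.
  have hcompact : CompactSpace (Metric.closedBall (0 : Fin 2 → ℝ) 1) :=
    isCompact_iff_compactSpace.1 (isCompact_closedBall 0 1)
  refine tendsto_average_of_tendsto_on_dense
    (F.continuous.comp (continuous_scenery_codedMeasure w)) (C := 2 * ‖F‖) (fun t => ?_)
    measurableSet_iUnion_goodTimes
    ((F.continuous.tendsto _).comp (tendsto_scenery_goodTimes hw))
    tendsto_volume_diff_goodTimes_div
  have h1 := F.norm_coe_le_norm (scenery codedMeasure (codedPoint w) t)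
  have h2 := F.norm_coe_le_norm (boxNorm (normLebesgue 2))
  exact (abs_sub _ _).trans (by simp only [Real.norm_eq_abs, Function.comp_apply] at *; linarith)

theorem isUSMGenerating_codedMeasure : IsUSMGenerating codedMeasure (lebesgueEFD 2) := by
  refine ⟨inferInstance, IsProbabilityMeasure.ne_zero _, ?_⟩
  filter_upwards [ae_mem_range_codedPoint, ae_eventually_mem_centralPoints]
  rintro _ ⟨w, rfl⟩ hw
  exact generatesAt_codedPoint hw

theorem mainTheorem12 :
    -- smooth maps: a homogeneous set and a smooth map, injective on it, that lowers the dimension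
    (IsHomogeneousSet cantorSquare ∧
      ∃ f : (Fin 2 → ℝ) → ℝ, ContDiff ℝ ∞ f ∧ InjOn f cantorSquare ∧
        dimH (f '' cantorSquare) < dimH cantorSquare ∧
        ∀ y ∈ f '' cantorSquare,
          dimH (f '' cantorSquare) + dimH (cantorSquare ∩ f ⁻¹' {y}) < dimH cantorSquare) ∧
    -- measures: a uniformly scaling measure of dimension above one with an injective projection
    (∃ (μ : ProbabilityMeasure (Fin 2 → ℝ)) (P : Measure (Measure (Fin 2 → ℝ))) (α : ℝ),
      IsEFD P ∧ IsUSMGenerating (μ : Measure (Fin 2 → ℝ)) P ∧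
      1 < α ∧ HasExactDim (μ : Measure (Fin 2 → ℝ)) α ∧ (∀ᵐ ν ∂P, HasExactDim ν α) ∧
      InjOn proj₁ (μ : Measure (Fin 2 → ℝ)).support ∧
      ∀ᵐ x ∂(μ : Measure (Fin 2 → ℝ)),
        upperDim ((μ : Measure (Fin 2 → ℝ)).map proj₁) +
          upperDim (fibreMeas (μ : Measure (Fin 2 → ℝ)) x) < (α : EReal)) := by
  refine ⟨⟨isHomogeneousSet_cantorSquare, exists_contDiff_injOn_dimH_lt⟩,
    ⟨codedMeasure, inferInstance⟩, lebesgueEFD 2, 2, isEFD_lebesgueEFD 2,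
    isUSMGenerating_codedMeasure, one_lt_two, hasExactDim_codedMeasure,
    ae_lebesgueEFD_iff.2 (by simpa using hasExactDim_normLebesgue 2),
    injOn_proj₁_range_codedPoint.mono support_codedMeasure_subset, ae_upperDim_add_lt⟩
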